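/- Let $\Omega\subset\mathbb R^n$ be a connected open set. A function $u:\Omega\to\mathbb R$ is called strictly convex if $u(ax+by)<a\,u(x)+b\,u(y)$ whenever $x\neq y$, the segment $[x,y]$ is contained in $\Omega$, $a,b>0$ and $a+b=1$. For $x_0\in\Omega$ put $$\partial u(x_0)=\{p\in\mathbb R^n:\ u(x)\ge u(x_0)+p\cdot(x-x_0)\ \text{ for all } x\in\Omega\},$$ let $\mathcal M u(E)=\big|\bigcup_{x\in E}\partial u(x)\big|$ for Borel sets $E\subset\Omega$ (the Monge–Ampère measure of $u$), and let $u^*(p)=\sup_{x\in\Omega}\{x\cdot p-u(x)\}$ (the Legendre transform of $u$). For a function $\rho\ge 0$ on $\Omega$, the inequality $\det D^2u\le\rho$ in $\Omega$ in the sense of Aleksandrov means $\mathcal M u(E)\le\int_E\rho\,dx$ for every Borel set $E\subset\Omega$, and $\det D^2u\ge\rho$ is defined likewise with the inequality reversed. **Theorem 1.5.** Let $0<\lambda\le\Lambda$ be constants. Let $f:\Omega\to\mathbb R$ be measurable with $\lambda\le f\le\Lambda$ almost everywhere, and let $F:\Omega\times\mathbb R\to\mathbb R$ and $G:\mathbb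 R^n\times\mathbb R\to\mathbb R$ be locally Lipschitz with $\lambda\le F\le\Lambda$ and $\lambda\le G\le\Lambda$. Let $u\ge v$ be two $C^1$ strictly convex functions on $\Omega$ such that, in the sense of Aleksandrov, $$\det D^2u(x)\le f(x)\,\frac{F(x,u(x))}{G\big(\nabla u(x),u^*(\nabla u(x))\big)}\quad\text{in }\Omega$$ and $$\det D^2v(x)\ge f(x)\,\frac{F(x,v(x))}{G\big(\nabla v(x),v^*(\nabla v(x))\big)}\quad\text{in }\Omega.$$ Then either $u>v$ everywhere in $\Omega$, or $u\equiv v$ in $\Omega$. -/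

import Mathlib

open MeasureTheory Set
open scoped ENNReal

namespace MongeAmpere

/-- Strict convexity of `u` on an open set `Ω` that need not be convex: the strict convexity
inequality holds along every segment contained in `Ω`. For convex `Ω` this is
`StrictConvexOn ℝ Ω u`. -/
def StrictlyConvex {n : ℕ} (Ω : Set (EuclideanSpace ℝ (Fin n)))
    (u : EuclideanSpace ℝ (Fin n) → ℝ) : Prop :=
  ∀ x y : EuclideanSpace ℝ (Fin n), segment ℝ x y ⊆ Ω → x ≠ y →
    ∀ a b : ℝ, 0 < a → 0 < b → a + b = 1 → u (a • x + b • y) < a * u x + b * u y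

/-- The subgradient `∂u(x₀) = {p : u(x) ≥ u(x₀) + p · (x - x₀) for all x ∈ Ω}`. -/
def subgradient {n : ℕ} (Ω : Set (EuclideanSpace ℝ (Fin n)))
    (u : EuclideanSpace ℝ (Fin n) → ℝ) (x₀ : EuclideanSpace ℝ (Fin n)) :
    Set (EuclideanSpace ℝ (Fin n)) :=
  {p | ∀ x ∈ Ω, u x₀ + inner ℝ p (x - x₀) ≤ u x}

/-- The Monge-Ampère measure `ℳu(E) = |∂u(E)|`, where `∂u(E) = ⋃_{x ∈ E} ∂u(x)`, as a function
of the Borel set `E ⊆ Ω`. -/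
noncomputable def maMeasure {n : ℕ} (Ω : Set (EuclideanSpace ℝ (Fin n)))
    (u : EuclideanSpace ℝ (Fin n) → ℝ) (E : Set (EuclideanSpace ℝ (Fin n))) : ℝ≥0∞ :=
  volume (⋃ x ∈ E, subgradient Ω u x)

/-- The Legendre transform `u^*(p) = sup_{x ∈ Ω} (x · p - u(x))` (`u` being `+∞` outside `Ω`).
It is only ever evaluated at `p = ∇u(x)`; if that `p` lies in `∂u(x)`, the supremum is attained
at `x`. -/
noncomputable def legendre {n : ℕ} (Ω : Set (EuclideanSpace ℝ (Fin n)))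
    (u : EuclideanSpace ℝ (Fin n) → ℝ) (p : EuclideanSpace ℝ (Fin n)) : ℝ :=
  ⨆ x : Ω, (inner ℝ (x : EuclideanSpace ℝ (Fin n)) p - u x)

/-- The right-hand side `f(x) F(x, u(x)) / G(∇u(x), u^*(∇u(x)))` of the equation. -/
noncomputable def rhs {n : ℕ} (Ω : Set (EuclideanSpace ℝ (Fin n)))
    (f : EuclideanSpace ℝ (Fin n) → ℝ) (F G : EuclideanSpace ℝ (Fin n) × ℝ → ℝ)
    (u : EuclideanSpace ℝ (Fin n) → ℝ) (x : EuclideanSpace ℝ (Fin n)) : ℝ :=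
  f x * (F (x, u x) / G (gradient u x, legendre Ω u (gradient u x)))

/-- `det D²u ≤ ρ` in `Ω` in the sense of Aleksandrov: `ℳu ≤ ρ dx` as measures on `Ω`. -/
def DetHessianLE {n : ℕ} (Ω : Set (EuclideanSpace ℝ (Fin n)))
    (u ρ : EuclideanSpace ℝ (Fin n) → ℝ) : Prop :=
  ∀ E ⊆ Ω, MeasurableSet E → maMeasure Ω u E ≤ ∫⁻ x in E, ENNReal.ofReal (ρ x)

/-- `det D²u ≥ ρ` in `Ω` in the sense of Aleksandrov: `ℳu ≥ ρ dx` as measures on `Ω`. -/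
def DetHessianGE {n : ℕ} (Ω : Set (EuclideanSpace ℝ (Fin n)))
    (u ρ : EuclideanSpace ℝ (Fin n) → ℝ) : Prop :=
  ∀ E ⊆ Ω, MeasurableSet E → ∫⁻ x in E, ENNReal.ofReal (ρ x) ≤ maMeasure Ω u E

end MongeAmpere

/-!
The proof is local. Since `det D²v` is bounded below, `∂v` is nonempty on a dense set, so by
continuity `∇v(x) ∈ ∂v(x)` at every point, and near a point where `u` touches `v` from above also
`∇u(x) ∈ ∂u(x)`. There the Legendre transforms are explicit, `u*(∇u(x)) = x · ∇u(x) - u(x)`, and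
the Lipschitz bounds on `F` and `G` turn the two inequalities into inequalities between the
measures of the images of `∇u` and `∇v`, with densities `ρ_u` and `ρ_v` satisfying
`ρ_u ≤ (1 + L (|u - v| + |∇u - ∇v|)) ρ_v`.

Suppose that `u` touches `v` at `x₀`, but does not agree with `v` near `x₀`. For small `a > 0` and
for `p` in a small ball `W` of slopes, let `C_a` be the set of the points at which some function
`u - (1 - a) v - a p · x` attains its minimum over a ball about `x₀`. On `C_a` the map
`P = (∇u - (1 - a) ∇v) / a` is the slope `p`, so `P(C_a) = W`, and `u - v` and `∇u - ∇v` are `O(a)`,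
so `ρ_u ≤ (1 + M a) ρ_v`. Two facts give the bound `|W| ≤ K |C_a|` with `K` independent of `a`:

* `P` maps null subsets of `C_a` to null sets. On `C_a`, `u` is touched from below by
  `(1 - a) v + a p · x`, and the Monge-Ampère measure of a sum of convex functions is at least that
  of each summand, so the slopes `a P` of a compact subset are controlled by its image under `∇u`
  (`measure_subgradientImage_le`, proved by mollification, and `measure_image_slopes_le`).
* The monotone maps `∇u` and `∇v` are differentiable almost everywhere
  (`ae_differentiableAt_of_monotone`). With `S = (1 - a) D²v` and `Q = D²u - S ≥ 0`, the bound
  `det D²u ≤ (1 + M a) det D²v` forces `det (Q / a)` to be bounded (`det_sub_le`), because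
  `det (S + Q) ≥ det S (1 + tr S⁻¹Q)`.

As `a → 0`, the sets `C_a` accumulate on a set of measure at least `|W| / K`
(`le_measure_limitPoints`). Its points `x` lie in the contact set `{u = v}` and minimize
`v - p · x` over it for some `p ∈ W`; as `W` is chosen away from the slopes of `v` on the contact
set, the open convex set `{v - p · z < v(x) - p · x}` is nonempty, has `x` on its boundary and
misses `{u = v}`. Hence `x` is not a point of density of `{u = v}`, and Lebesgue's density theorem
shows that the limit set is null (`measure_eq_zero_of_touching_convex`), a contradiction. So
`{u = v}` is open as well as closed in the connected set `Ω`.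
-/

namespace MongeAmpere

open Filter Topology Metric

/-! ### Determinants of sums of positive operators -/

/-- Simultaneous diagonalization of a positive definite and a positive semidefinite form, at the
level of determinants: the `c i` are the eigenvalues of `S⁻¹ Q`. -/
lemma exists_relative_eigenvalues {ι : Type*} [Fintype ι] [DecidableEq ι] {S Q : Matrix ι ι ℝ}
    (hS : S.PosDef) (hQ : Q.PosSemidef) :
    ∃ c : ι → ℝ, (∀ i, 0 ≤ c i) ∧ Q.det = S.det * ∏ i, c i ∧
      (S + Q).det = S.det * ∏ i, (1 + c i) := by
  obtain ⟨B, hBS⟩ : ∃ B : Matrix ι ι ℝ, S = B.conjTranspose * B := by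
    open scoped MatrixOrder in
    obtain ⟨B, hB⟩ := CStarAlgebra.nonneg_iff_eq_star_mul_self.mp hS.posSemidef.nonneg
    exact ⟨B, hB⟩
  have hBd : IsUnit B.det := by
    rw [isUnit_iff_ne_zero]
    intro h
    have := hS.det_pos
    rw [hBS, Matrix.det_mul, h, mul_zero] at this
    exact this.false
  subst hBS
  obtain ⟨M, hM⟩ : ∃ M, M = (B⁻¹).conjTranspose * Q * B⁻¹ := ⟨_, rfl⟩
  have hMp : M.PosSemidef := hM ▸ hQ.conjTranspose_mul_mul_same _
  have h1 : B.conjTranspose * M * B = Q := by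
    have e1 : B⁻¹ * B = 1 := Matrix.nonsing_inv_mul B hBd
    have e2 : B.conjTranspose * (B⁻¹).conjTranspose = 1 := by
      rw [← Matrix.conjTranspose_mul, e1, Matrix.conjTranspose_one]
    calc B.conjTranspose * M * B
        = (B.conjTranspose * (B⁻¹).conjTranspose) * Q * (B⁻¹ * B) := by
          rw [hM]; simp only [Matrix.mul_assoc]
      _ = Q := by rw [e1, e2, Matrix.one_mul, Matrix.mul_one]
  have h2 : B.conjTranspose * (1 + M) * B = B.conjTranspose * B + Q := by
    rw [Matrix.mul_add, Matrix.add_mul, h1, Matrix.mul_one]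
  refine ⟨hMp.1.eigenvalues, hMp.eigenvalues_nonneg, ?_, ?_⟩
  · conv_lhs => rw [← h1]
    rw [Matrix.det_mul, Matrix.det_mul, Matrix.det_mul, hMp.1.det_eq_prod_eigenvalues]
    simp only [RCLike.ofReal_real_eq_id, id]
    ring
  · have h3 : (1 + M).det = ∏ i, (1 + hMp.1.eigenvalues i) := by
      have h4 := Matrix.eval_charpoly M (-1)
      rw [hMp.1.charpoly_eq, Polynomial.eval_prod] at h4
      have h5 : Matrix.scalar ι (-1 : ℝ) - M = -(1 + M) := by
        rw [map_neg, map_one]; abel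
      rw [h5, Matrix.det_neg] at h4
      have h6 : ∏ i, (1 + hMp.1.eigenvalues i)
          = (-1) ^ Fintype.card ι * ∏ i, (-1 - hMp.1.eigenvalues i) := by
        rw [← Finset.card_univ, ← Finset.prod_const, ← Finset.prod_mul_distrib]
        exact Finset.prod_congr rfl fun i _ => by ring
      rw [h6]
      simp only [Polynomial.eval_sub, Polynomial.eval_X, Polynomial.eval_C,
        RCLike.ofReal_real_eq_id, id] at h4
      rw [h4, ← mul_assoc, ← mul_pow]
      simp
    rw [← h2, Matrix.det_mul, Matrix.det_mul, Matrix.det_mul, h3]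
    ring

section

variable {E : Type*} [NormedAddCommGroup E] [InnerProductSpace ℝ E] [FiniteDimensional ℝ E]

lemma exists_relative_eigenvalues_operator {S Q : E →L[ℝ] E}
    (hS : S.IsPositive) (hSd : S.det ≠ 0) (hQ : Q.IsPositive) :
    ∃ c : Fin (Module.finrank ℝ E) → ℝ, (∀ i, 0 ≤ c i) ∧ Q.det = S.det * ∏ i, c i ∧
      (S + Q).det = S.det * ∏ i, (1 + c i) := by
  set b := stdOrthonormalBasis ℝ E
  have hd : ∀ T : E →L[ℝ] E,
      ((T : E →ₗ[ℝ] E).toMatrix b.toBasis b.toBasis).det = T.det := fun T =>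
    LinearMap.det_toMatrix _ _
  have h1 : ((S : E →ₗ[ℝ] E).toMatrix b.toBasis b.toBasis).PosSemidef :=
    (LinearMap.posSemidef_toMatrix_iff b).mpr hS
  have h2 : ((Q : E →ₗ[ℝ] E).toMatrix b.toBasis b.toBasis).PosSemidef :=
    (LinearMap.posSemidef_toMatrix_iff b).mpr hQ
  have h3 := h1.posDef_iff_det_ne_zero.mpr (by rw [hd]; exact hSd)
  have := exists_relative_eigenvalues h3 h2
  rw [← map_add, ← ContinuousLinearMap.toLinearMap_add, hd, hd, hd] at this
  exact this

lemma IsPositive.det_nonneg {S : E →L[ℝ] E} (hS : S.IsPositive) : 0 ≤ S.det := by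
  set b := stdOrthonormalBasis ℝ E
  have h1 : ((S : E →ₗ[ℝ] E).toMatrix b.toBasis b.toBasis).PosSemidef :=
    (LinearMap.posSemidef_toMatrix_iff b).mpr hS
  have := h1.det_nonneg
  rwa [LinearMap.det_toMatrix] at this

lemma det_le_det_add {S Q : E →L[ℝ] E} (hS : S.IsPositive) (hQ : Q.IsPositive) :
    S.det ≤ (S + Q).det := by
  by_cases hd : S.det = 0
  · rw [hd]; exact IsPositive.det_nonneg (hS.add hQ)
  · obtain ⟨c, hc, -, h⟩ := exists_relative_eigenvalues_operator hS hd hQ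
    rw [h]
    refine le_mul_of_one_le_right (IsPositive.det_nonneg hS) ?_
    exact Finset.one_le_prod fun i _ => by linarith [hc i]

/-- If `A ≥ (1 - a) B ≥ 0` and `det A` exceeds `det B` by a factor at most `1 + M a`, then
the difference `A - (1 - a) B` is of relative size `a` with respect to `B`: expanding
`det A = det (S + Q)` with `S = (1 - a) B` to first order bounds the trace of `S⁻¹ Q`, hence all
its eigenvalues. -/
lemma det_sub_le {A B : E →L[ℝ] E} {a M : ℝ} (ha : 0 < a) (ha' : a ≤ 1 / 2)
    (hB : B.IsPositive) (hBd : 0 < B.det) (hAB : (A - (1 - a) • B).IsPositive)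
    (hdet : A.det ≤ (1 + M * a) * B.det) :
    (A - (1 - a) • B).det
      ≤ B.det * (2 ^ Module.finrank ℝ E * (M + Module.finrank ℝ E) * a) ^ Module.finrank ℝ E := by
  set N := Module.finrank ℝ E
  have h1a : (0 : ℝ) ≤ 1 - a := by linarith
  have hS : ((1 - a) • B).IsPositive := hB.smul_of_nonneg h1a
  have hSd : ((1 - a) • B).det = (1 - a) ^ N * B.det := by
    simp only [ContinuousLinearMap.det, ContinuousLinearMap.toLinearMap_smul, LinearMap.det_smul]
    rfl
  have hpow : (0 : ℝ) < (1 - a) ^ N := pow_pos (by linarith) _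
  have hSpos : 0 < ((1 - a) • B).det := by rw [hSd]; positivity
  obtain ⟨c, hc, hQ, hA⟩ := exists_relative_eigenvalues_operator hS hSpos.ne' hAB
  rw [add_sub_cancel, hSd] at hA
  rw [hSd] at hQ
  have hsum : 1 + ∑ i, c i ≤ ∏ i, (1 + c i) := by
    induction (Finset.univ : Finset (Fin N)) using Finset.induction_on with
    | empty => simp
    | insert i s hi ih =>
      rw [Finset.sum_insert hi, Finset.prod_insert hi]
      have : 0 ≤ ∑ j ∈ s, c j := Finset.sum_nonneg fun j _ => hc j
      nlinarith [hc i]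
  have h2 : (1 - a) ^ N * (1 + ∑ i, c i) ≤ 1 + M * a := by
    have : B.det * ((1 - a) ^ N * (1 + ∑ i, c i)) ≤ B.det * (1 + M * a) := by
      calc B.det * ((1 - a) ^ N * (1 + ∑ i, c i))
          = (1 - a) ^ N * B.det * (1 + ∑ i, c i) := by ring
        _ ≤ (1 - a) ^ N * B.det * ∏ i, (1 + c i) := by gcongr
        _ = A.det := hA.symm
        _ ≤ B.det * (1 + M * a) := by linarith
    exact le_of_mul_le_mul_left this hBd
  have hbern : 1 - N * a ≤ (1 - a) ^ N := by
    have := one_add_mul_le_pow (show (-2 : ℝ) ≤ -a by linarith) N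
    rw [← sub_eq_add_neg] at this
    linarith
  have hhalf : (1 / 2 : ℝ) ^ N ≤ (1 - a) ^ N := by gcongr; linarith
  have hs0 : 0 ≤ ∑ i, c i := Finset.sum_nonneg fun i _ => hc i
  have h3 : ∑ i, c i ≤ 2 ^ N * (M + N) * a := by
    have h4 : (1 / 2 : ℝ) ^ N * ∑ i, c i ≤ (M + N) * a := by
      calc (1 / 2 : ℝ) ^ N * ∑ i, c i ≤ (1 - a) ^ N * ∑ i, c i := by gcongr
        _ ≤ (M + N) * a := by linarith
    calc ∑ i, c i = 2 ^ N * ((1 / 2 : ℝ) ^ N * ∑ i, c i) := by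
          rw [← mul_assoc, ← mul_pow]; norm_num
      _ ≤ 2 ^ N * ((M + N) * a) := by gcongr
      _ = _ := by ring
  have h5 : ∏ i, c i ≤ (∑ i, c i) ^ N := by
    calc ∏ i, c i ≤ ∏ _i : Fin N, ∑ j, c j :=
          Finset.prod_le_prod (fun i _ => hc i) fun i _ =>
            Finset.single_le_sum (fun j _ => hc j) (Finset.mem_univ i)
      _ = _ := by simp
  have h6 : (1 - a) ^ N ≤ 1 := pow_le_one₀ h1a (by linarith)
  have hp0 : 0 ≤ ∏ i, c i := Finset.prod_nonneg fun i _ => hc i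
  rw [hQ]
  calc (1 - a) ^ N * B.det * ∏ i, c i ≤ 1 * B.det * (∑ i, c i) ^ N := by gcongr
    _ ≤ B.det * (2 ^ N * (M + N) * a) ^ N := by rw [one_mul]; gcongr

end

/-! ### Upper limits of sets and points of density -/

/-- Fatou's lemma for upper limits of sets: the set of all limits of sequences of points taken
from infinitely many of the sets `T k`. -/
lemma le_measure_limitPoints {E : Type*} [PseudoMetricSpace E] [ProperSpace E] [MeasurableSpace E]
    [OpensMeasurableSpace E] (μ : Measure E) [IsFiniteMeasureOnCompacts μ] {T : ℕ → Set E}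
    {R : Set E} (hR : Bornology.IsBounded R) (hT : ∀ k, T k ⊆ R) {m : ℝ≥0∞}
    (hm : ∀ k, m ≤ μ (T k)) :
    m ≤ μ {x | ∃ (k : ℕ → ℕ) (y : ℕ → E), Tendsto k atTop atTop ∧ (∀ j, y j ∈ T (k j)) ∧
      Tendsto y atTop (𝓝 x)} := by
  set F : ℕ → Set E := fun n => closure (⋃ k ≥ n, T k)
  have hFR : ∀ n, F n ⊆ closure R := fun n =>
    closure_mono (iUnion₂_subset fun k _ => hT k)
  have hFanti : Antitone F := fun i j hij =>
    closure_mono (biUnion_subset_biUnion_left fun k hk => le_trans hij hk)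
  have h1 : μ (⋂ n, F n) = ⨅ n, μ (F n) := by
    refine hFanti.measure_iInter (fun n => isClosed_closure.measurableSet.nullMeasurableSet) ⟨0, ?_⟩
    exact ((measure_mono (hFR 0)).trans_lt hR.isCompact_closure.measure_lt_top).ne
  have h2 : m ≤ μ (⋂ n, F n) := by
    rw [h1]
    refine le_iInf fun n => (hm n).trans (measure_mono ?_)
    exact (subset_biUnion_of_mem (u := fun k => T k) (le_refl n)).trans subset_closure
  refine h2.trans (measure_mono fun x hx => ?_)
  have h3 : ∀ n : ℕ, ∃ k y, n ≤ k ∧ y ∈ T k ∧ dist x y < 1 / ((n : ℝ) + 1) := fun n => by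
    have := mem_iInter.mp hx n
    obtain ⟨y, hy, hd⟩ := Metric.mem_closure_iff.mp this _ (Nat.one_div_pos_of_nat (n := n))
    obtain ⟨k, hk, hy⟩ := mem_iUnion₂.mp hy
    exact ⟨k, y, hk, hy, hd⟩
  choose k y hk hy hd using h3
  refine ⟨k, y, tendsto_atTop_mono hk tendsto_id, hy, ?_⟩
  rw [tendsto_iff_dist_tendsto_zero]
  refine squeeze_zero (fun _ => dist_nonneg) (fun n => ?_) tendsto_one_div_add_atTop_nhds_zero_nat
  rw [dist_comm]
  exact (hd n).le

/-- A point of `S` which lies on the boundary of an open convex set disjoint from `S` is not a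
point of density of `S`, since that convex set contains a cone at the point. -/
lemma measure_eq_zero_of_touching_convex {E : Type*} [NormedAddCommGroup E]
    [NormedSpace ℝ E] [FiniteDimensional ℝ E] [MeasurableSpace E] [BorelSpace E] (μ : Measure E)
    [μ.IsAddHaarMeasure] {S T : Set E} (hS : MeasurableSet S) (hTS : T ⊆ S)
    (hT : ∀ x ∈ T, ∃ D : Set E, IsOpen D ∧ Convex ℝ D ∧ D.Nonempty ∧ x ∈ closure D ∧
      Disjoint D S) : μ T = 0 := by
  have hae := Besicovitch.ae_tendsto_measure_inter_div_of_measurableSet μ hS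
  rw [ae_iff] at hae
  refine measure_mono_null ?_ hae
  intro x hx hlim
  simp only [indicator_of_mem (hTS hx), Pi.one_apply] at hlim
  obtain ⟨D, hDo, hDc, ⟨z, hz⟩, hxD, hDS⟩ := hT x hx
  obtain ⟨ρ, hρ, hball⟩ := Metric.isOpen_iff.mp hDo z hz
  set R := dist z x + ρ with hR
  have hRpos : 0 < R := by positivity
  set N := Module.finrank ℝ E
  set c := ENNReal.ofReal ((ρ / R) ^ N)
  have hc : c ≠ 0 := by
    simp only [c, ne_eq, ENNReal.ofReal_eq_zero, not_le]; positivity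
  have hbound : ∀ r ∈ Ioc 0 R, μ (S ∩ closedBall x r) / μ (closedBall x r) + c ≤ 1 := by
    intro r hr
    set t := r / R with ht
    have ht0 : 0 < t := div_pos hr.1 hRpos
    have ht1 : t ≤ 1 := (div_le_one hRpos).mpr hr.2
    have htR : r = t * R := by rw [ht]; field_simp
    set b := ball (x + t • (z - x)) (t * ρ)
    have hbD : b ⊆ D := by
      intro w hw
      have h1 : x + t⁻¹ • (w - x) ∈ D := by
        apply hball
        have : x + t⁻¹ • (w - x) - z = t⁻¹ • (w - (x + t • (z - x))) := by
          rw [smul_sub, smul_sub, smul_add, smul_smul, inv_mul_cancel₀ ht0.ne', one_smul]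
          abel
        rw [mem_ball, dist_eq_norm, this, norm_smul, ← dist_eq_norm, Real.norm_of_nonneg
          (inv_nonneg.mpr ht0.le)]
        have := mem_ball.mp hw
        rw [inv_mul_lt_iff₀ ht0]
        exact this
      have h2 := hDc.combo_interior_closure_subset_interior ht0 (sub_nonneg.mpr ht1)
        (add_sub_cancel t 1)
      rw [hDo.interior_eq] at h2
      apply h2
      refine ⟨_, smul_mem_smul_set h1, _, smul_mem_smul_set hxD, ?_⟩
      simp only [smul_add, smul_smul, mul_inv_cancel₀ ht0.ne', one_smul, sub_smul]
      abel
    have hbcb : b ⊆ closedBall x r := by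
      intro w hw
      have h1 := mem_ball.mp hw
      rw [mem_closedBall]
      calc dist w x ≤ dist w (x + t • (z - x)) + dist (x + t • (z - x)) x := dist_triangle _ _ _
        _ ≤ t * ρ + t * dist z x := by
          gcongr
          rw [dist_eq_norm, add_sub_cancel_left, norm_smul, Real.norm_of_nonneg ht0.le,
            dist_eq_norm]
        _ = r := by rw [htR, hR]; ring
    have hsum : μ (S ∩ closedBall x r) + μ b ≤ μ (closedBall x r) := by
      rw [← measure_union (hDS.mono_left hbD |>.symm.mono_left inter_subset_left)
        measurableSet_ball]
      exact measure_mono (union_subset inter_subset_right hbcb)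
    have hcb0 : μ (closedBall x r) ≠ 0 := (measure_closedBall_pos μ x hr.1).ne'
    have hcbt : μ (closedBall x r) ≠ ∞ := measure_closedBall_lt_top.ne
    have hbc : μ b / μ (closedBall x r) = c := by
      have h1 : μ b = c * μ (closedBall x r) := by
        rw [Measure.addHaar_ball_of_pos μ _ (by positivity),
          Measure.addHaar_closedBall μ _ hr.1.le,
          ← mul_assoc, ← ENNReal.ofReal_mul (by positivity), ← mul_pow]
        congr 3
        rw [htR]; field_simp
      rw [h1, ENNReal.mul_div_cancel_right hcb0 hcbt]
    rw [← hbc, ← ENNReal.add_div]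
    exact ENNReal.div_le_of_le_mul (by rwa [one_mul])
  have hlim2 : Tendsto (fun r => μ (S ∩ closedBall x r) / μ (closedBall x r) + c) (𝓝[>] 0)
      (𝓝 (1 + c)) := hlim.add tendsto_const_nhds
  have h3 : 1 + c ≤ 1 := le_of_tendsto hlim2
    (eventually_of_mem (Ioc_mem_nhdsGT hRpos) hbound)
  exact (ENNReal.lt_add_right ENNReal.one_ne_top hc).not_ge h3

/-! ### Second derivatives of functions with a differentiable gradient -/

section

variable {E : Type*} [NormedAddCommGroup E] [InnerProductSpace ℝ E] [FiniteDimensional ℝ E]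

lemma inner_apply_symm_of_hasGradientAt {φ : E → ℝ} {X : E → E} {x : E} {M : E →L[ℝ] E}
    (hX : ∀ᶠ y in 𝓝 x, HasGradientAt φ (X y) y) (hM : HasFDerivAt X M x) (v w : E) :
    inner ℝ (M v) w = inner ℝ v (M w) := by
  set I : E →L[ℝ] (E →L[ℝ] ℝ) := innerSL ℝ with hI
  have h1 : ∀ᶠ y in 𝓝 x, HasFDerivAt φ (I (X y)) y := by
    filter_upwards [hX] with y hy using hy.hasFDerivAt
  have h2 : HasFDerivAt (fun y => I (X y)) (I.comp M) x := I.hasFDerivAt.comp x hM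
  have h3 := second_derivative_symmetric_of_eventually h1 h2 v w
  rw [real_inner_comm (M w) v]
  exact h3

lemma HasGradientAt.hasDerivAt_line {φ : E → ℝ} {p x e : E} {s : ℝ}
    (h : HasGradientAt φ p (x + s • e)) :
    HasDerivAt (fun s : ℝ => φ (x + s • e)) (inner ℝ p e) s := by
  have h1 : HasDerivAt (fun s : ℝ => x + s • e) e s := by
    simpa using ((hasDerivAt_id s).smul_const e).const_add x
  exact h.hasFDerivAt.comp_hasDerivAt s h1

/-- The necessary second order condition at a local minimum, for a function whose gradient is
differentiable at the minimum. -/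
lemma isPositive_of_isLocalMin {φ : E → ℝ} {X : E → E} {x : E} {M : E →L[ℝ] E}
    (hX : ∀ᶠ y in 𝓝 x, HasGradientAt φ (X y) y) (hM : HasFDerivAt X M x) (hmin : IsLocalMin φ x) :
    M.IsPositive := by
  refine ⟨fun v w => inner_apply_symm_of_hasGradientAt hX hM v w, fun e => ?_⟩
  by_contra hneg
  change ¬ 0 ≤ inner ℝ (M e) e at hneg
  push Not at hneg
  set ψ : ℝ → ℝ := fun s => φ (x + s • e)
  have hline : Tendsto (fun s : ℝ => x + s • e) (𝓝 0) (𝓝 x) :=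
    Continuous.tendsto' (by fun_prop) 0 x (by simp)
  have hX0 : ∀ᶠ s : ℝ in 𝓝 0, HasDerivAt ψ (inner ℝ (X (x + s • e)) e) s := by
    filter_upwards [hline.eventually hX] with s hs using HasGradientAt.hasDerivAt_line hs
  have hd : deriv ψ =ᶠ[𝓝 0] fun s => inner ℝ (X (x + s • e)) e := by
    filter_upwards [hX0] with s hs using hs.deriv
  have hdd : HasDerivAt (fun s : ℝ => inner ℝ (X (x + s • e)) e) (inner ℝ (M e) e) 0 := by
    have h1 : HasDerivAt (fun s : ℝ => x + s • e) e 0 := by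
      simpa using ((hasDerivAt_id (0 : ℝ)).smul_const e).const_add x
    have h2 : HasDerivAt (fun s : ℝ => X (x + s • e)) (M e) 0 := by
      have hM' : HasFDerivAt X M (x + (0 : ℝ) • e) := by simpa using hM
      exact hM'.comp_hasDerivAt 0 h1
    simpa using h2.inner ℝ (hasDerivAt_const (0 : ℝ) e)
  have hdd' : deriv (deriv ψ) 0 = inner ℝ (M e) e := by
    rw [hd.deriv_eq, hdd.deriv]
  have hminψ : IsLocalMin ψ 0 := by
    have : ∀ᶠ s : ℝ in 𝓝 0, φ x ≤ φ (x + s • e) := hline.eventually hmin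
    filter_upwards [this] with s hs
    simpa [ψ] using hs
  have hmaxψ : IsLocalMax ψ 0 :=
    isLocalMax_of_deriv_deriv_neg (by rw [hdd']; exact hneg) hminψ.deriv_eq_zero
      hX0.self_of_nhds.continuousAt
  have hconst : ψ =ᶠ[𝓝 0] fun _ => ψ 0 := by
    filter_upwards [hminψ, hmaxψ] with s h1 h2 using le_antisymm h2 h1
  have h0 : deriv (deriv ψ) 0 = 0 := by
    rw [hconst.deriv.deriv_eq]; simp
  rw [hdd'] at h0
  exact hneg.ne h0

variable [MeasurableSpace E] [BorelSpace E]

lemma addHaar_image_le_of_lipschitzOnWith (μ : Measure E) [μ.IsAddHaarMeasure] {K : NNReal}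
    {f : E → E} {s : Set E} (hf : LipschitzOnWith K f s) :
    μ (f '' s) ≤ (K : ℝ≥0∞) ^ Module.finrank ℝ E * μ s := by
  have h := Measure.isAddLeftInvariant_eq_smul μ (Measure.hausdorffMeasure (Module.finrank ℝ E))
  rw [h, Measure.smul_apply, Measure.smul_apply, ENNReal.smul_def, ENNReal.smul_def, smul_eq_mul,
    smul_eq_mul, mul_left_comm]
  gcongr
  have := hf.hausdorffMeasure_image_le (d := Module.finrank ℝ E) (by positivity)
  rwa [ENNReal.rpow_natCast] at this

/-- A continuous monotone map is differentiable almost everywhere: `id + X` is expanding, so it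
has a Lipschitz left inverse `J` (Minty), which is differentiable almost everywhere by
Rademacher's theorem. The points outside the image under `J` of the set where `J` is not
differentiable or has a singular derivative form a set of full measure, where the inverse function
theorem applies. -/
lemma ae_differentiableAt_of_monotone (μ : Measure E) [μ.IsAddHaarMeasure] {X : E → E} {S : Set E}
    (hS : IsOpen S) (hX : ContinuousOn X S)
    (hmono : ∀ x ∈ S, ∀ y ∈ S, 0 ≤ inner ℝ (X x - X y) (x - y)) :
    ∀ᵐ x ∂μ, x ∈ S → DifferentiableAt ℝ X x := by
  set Z : E → E := fun x => x + X x
  have hexp : ∀ x ∈ S, ∀ y ∈ S, dist x y ≤ dist (Z x) (Z y) := by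
    intro x hx y hy
    have h1 : Z x - Z y = (x - y) + (X x - X y) := by simp only [Z]; abel
    rw [dist_eq_norm, dist_eq_norm, h1]
    refine (sq_le_sq₀ (norm_nonneg _) (norm_nonneg _)).mp ?_
    rw [norm_add_sq_real, real_inner_comm]
    nlinarith [hmono x hx y hy, sq_nonneg ‖X x - X y‖]
  have hinj : InjOn Z S := fun x hx y hy hxy => by
    have := hexp x hx y hy
    rw [hxy, dist_self] at this
    exact dist_le_zero.mp this
  have hLip : LipschitzOnWith 1 (Function.invFunOn Z S) (Z '' S) := by
    refine LipschitzOnWith.of_dist_le_mul ?_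
    rintro _ ⟨x, hx, rfl⟩ _ ⟨y, hy, rfl⟩
    rw [hinj.leftInvOn_invFunOn hx, hinj.leftInvOn_invFunOn hy, NNReal.coe_one, one_mul]
    exact hexp x hx y hy
  obtain ⟨J, hJ, hJeq⟩ := hLip.extend_finite_dimension
  have hJZ : ∀ x ∈ S, J (Z x) = x := fun x hx => by
    rw [← hJeq (mem_image_of_mem Z hx), hinj.leftInvOn_invFunOn hx]
  have hbad1 : μ (J '' {z | ¬ DifferentiableAt ℝ J z}) = 0 := by
    have h0 : μ {z | ¬ DifferentiableAt ℝ J z} = 0 := ae_iff.mp (hJ.ae_differentiableAt (μ := μ))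
    have := addHaar_image_le_of_lipschitzOnWith μ (hJ.lipschitzOnWith (s := {z | ¬ DifferentiableAt ℝ J z}))
    rw [h0, mul_zero] at this
    exact nonpos_iff_eq_zero.mp this
  have hbad2 : μ (J '' {z | DifferentiableAt ℝ J z ∧ (fderiv ℝ J z).det = 0}) = 0 :=
    addHaar_image_eq_zero_of_det_fderivWithin_eq_zero μ
      (fun z hz => hz.1.hasFDerivAt.hasFDerivWithinAt) fun z hz => hz.2
  filter_upwards [measure_eq_zero_iff_ae_notMem.mp hbad1, measure_eq_zero_iff_ae_notMem.mp hbad2]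
    with x h1 h2 hx
  have hd : DifferentiableAt ℝ J (Z x) := by
    by_contra h
    exact h1 ⟨Z x, h, hJZ x hx⟩
  have hdet : (fderiv ℝ J (Z x)).det ≠ 0 := fun h => h2 ⟨Z x, ⟨hd, h⟩, hJZ x hx⟩
  have hXx : ContinuousAt X x := hX.continuousAt (hS.mem_nhds hx)
  have h3 : HasFDerivAt J
      ((fderiv ℝ J (Z x)).toContinuousLinearEquivOfDetNeZero hdet : E →L[ℝ] E) (Z x) := by
    simpa using hd.hasFDerivAt
  have h4 := h3.of_local_left_inverse (g := Z) (a := x) (continuousAt_id.add hXx)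
    (by filter_upwards [hS.mem_nhds hx] with y hy using hJZ y hy)
  have h5 : X = fun y => Z y - y := by ext1 y; simp [Z]
  rw [h5]
  exact h4.differentiableAt.sub differentiableAt_id

end

section

variable {E : Type*} [NormedAddCommGroup E] [InnerProductSpace ℝ E] [FiniteDimensional ℝ E]

/-! ### Gradients of convex functions -/

lemma HasGradientAt.add {f g : E → ℝ} {p q x : E} (hf : HasGradientAt f p x)
    (hg : HasGradientAt g q x) : HasGradientAt (fun y => f y + g y) (p + q) x := by
  rw [hasGradientAt_iff_hasFDerivAt, map_add]
  exact hf.hasFDerivAt.add hg.hasFDerivAt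

lemma HasGradientAt.sub {f g : E → ℝ} {p q x : E} (hf : HasGradientAt f p x)
    (hg : HasGradientAt g q x) : HasGradientAt (fun y => f y - g y) (p - q) x := by
  rw [hasGradientAt_iff_hasFDerivAt, map_sub]
  exact hf.hasFDerivAt.sub hg.hasFDerivAt

lemma HasGradientAt.const_mul {f : E → ℝ} {p x : E} (c : ℝ) (hf : HasGradientAt f p x) :
    HasGradientAt (fun y => c * f y) (c • p) x := by
  have h : InnerProductSpace.toDual ℝ E (c • p) = c • InnerProductSpace.toDual ℝ E p := by
    ext y
    simp
  rw [hasGradientAt_iff_hasFDerivAt, h]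
  exact hf.hasFDerivAt.const_mul c

lemma hasGradientAt_inner (p x : E) : HasGradientAt (fun y => inner ℝ p y) p x := by
  rw [hasGradientAt_iff_hasFDerivAt]
  exact (InnerProductSpace.toDual ℝ E p).hasFDerivAt

lemma hasGradientAt_norm_sq (x : E) : HasGradientAt (fun y => ‖y‖ ^ 2) ((2 : ℝ) • x) x := by
  have h : InnerProductSpace.toDual ℝ E ((2 : ℝ) • x) = 2 • innerSL ℝ x := by
    rw [two_smul, two_smul, map_add]
    rfl
  rw [hasGradientAt_iff_hasFDerivAt, h]
  exact (hasStrictFDerivAt_norm_sq x).hasFDerivAt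

/-- The gradient at a local minimum of `φ - ⟪q, ·⟫` is `q`. -/
lemma HasGradientAt.eq_of_isLocalMin {φ : E → ℝ} {p q x : E} (h : HasGradientAt φ p x)
    (hmin : IsLocalMin (fun y => φ y - inner ℝ q y) x) : p = q := by
  have h1 := hmin.hasFDerivAt_eq_zero (HasGradientAt.sub h (hasGradientAt_inner q x)).hasFDerivAt
  rw [map_eq_zero_iff _ (InnerProductSpace.toDual ℝ E).injective] at h1
  exact sub_eq_zero.mp h1

lemma HasGradientAt.eq_of_eventually_le {φ : E → ℝ} {p q x : E} (h : HasGradientAt φ p x)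
    (hq : ∀ᶠ y in 𝓝 x, φ x + inner ℝ q (y - x) ≤ φ y) : p = q := by
  refine HasGradientAt.eq_of_isLocalMin h ?_
  filter_upwards [hq] with y hy
  rw [inner_sub_right] at hy
  linarith

lemma add_inner_le_of_convexOn {f : E → ℝ} {S : Set E} {p x y : E} (hf : ConvexOn ℝ S f)
    (hx : x ∈ S) (hy : y ∈ S) (h : HasGradientAt f p x) :
    f x + inner ℝ p (y - x) ≤ f y := by
  have h0 : HasGradientAt f p (x + (0 : ℝ) • (y - x)) := by simpa using h
  have h1 := (HasGradientAt.hasDerivAt_line h0).tendsto_slope_zero_right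
  have h2 : inner ℝ p (y - x) ≤ f y - f x := by
    refine le_of_tendsto h1 (eventually_of_mem (Ioc_mem_nhdsGT (zero_lt_one' ℝ)) fun t ht => ?_)
    have h3 := hf.2 hx hy (sub_nonneg.mpr ht.2) ht.1.le (sub_add_cancel 1 t)
    have h4 : (1 - t) • x + t • y = x + t • (y - x) := by
      rw [sub_smul, smul_sub, one_smul]; abel
    rw [h4, smul_eq_mul, smul_eq_mul] at h3
    rw [smul_eq_mul, inv_mul_le_iff₀ ht.1, zero_add, zero_smul, add_zero]
    linarith
  linarith

lemma inner_sub_nonneg_of_subgradients {F : Type*} [NormedAddCommGroup F] [InnerProductSpace ℝ F]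
    {f : F → ℝ} {p q x y : F}
    (hp : f x + inner ℝ p (y - x) ≤ f y) (hq : f y + inner ℝ q (x - y) ≤ f x) :
    0 ≤ inner ℝ (p - q) (x - y) := by
  have h : inner ℝ p (y - x) = - inner ℝ p (x - y) := by rw [← inner_neg_right, neg_sub]
  rw [inner_sub_left]
  linarith

lemma exists_hessian_of_convexOn {f : E → ℝ} (hf : ConvexOn ℝ univ f) (hf2 : ContDiff ℝ 2 f) :
    ∃ (X : E → E) (M : E → E →L[ℝ] E), (∀ x, HasGradientAt f (X x) x) ∧
      (∀ x, HasFDerivAt X (M x) x) ∧ ∀ x, (M x).IsPositive := by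
  have hd : ∀ x, HasGradientAt f (gradient f x) x := fun x =>
    (hf2.differentiable (by norm_num) x).hasGradientAt
  let I : StrongDual ℝ E →L[ℝ] E := LinearMap.toContinuousLinearMap
    { toFun := fun p => (InnerProductSpace.toDual ℝ E).symm p
      map_add' := by simp
      map_smul' := by simp }
  have hX : Differentiable ℝ (gradient f) := by
    have h1 : Differentiable ℝ (fderiv ℝ f) :=
      (hf2.fderiv_right (m := 1) (by norm_num)).differentiable (by norm_num)
    exact I.differentiable.comp h1
  refine ⟨gradient f, fun x => fderiv ℝ (gradient f) x, hd, fun x => (hX x).hasFDerivAt,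
    fun x => ?_⟩
  refine isPositive_of_isLocalMin (φ := fun y => f y - inner ℝ (gradient f x) y)
    (X := fun y => gradient f y - gradient f x) (x := x) (Eventually.of_forall fun y =>
      HasGradientAt.sub (hd y) (hasGradientAt_inner _ y)) ?_ ?_
  · exact (hX x).hasFDerivAt.sub_const _
  · refine Eventually.of_forall fun y => ?_
    have := add_inner_le_of_convexOn hf (mem_univ x) (mem_univ y) (hd x)
    rw [inner_sub_right] at this
    linarith

/-! ### Adding a convex function increases the Monge-Ampère measure -/

variable [MeasurableSpace E] [BorelSpace E]

lemma exists_contDiff_convexOn_approx {A : E → ℝ} (hA : ConvexOn ℝ univ A) {L : NNReal}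
    (hL : LipschitzWith L A) {δ : ℝ} (hδ : 0 < δ) :
    ∃ A' : E → ℝ, ConvexOn ℝ univ A' ∧ ContDiff ℝ 2 A' ∧ ∀ x, |A' x - A x| ≤ δ := by
  set μ : Measure E := Measure.addHaar
  set r : ℝ := δ / (L + 1) with hr
  have hr0 : 0 < r := by positivity
  let φ : ContDiffBump (0 : E) := ⟨r / 2, r, by positivity, by linarith⟩
  have hAc : Continuous A := hL.continuous
  have hex : ConvolutionExists (φ.normed μ) A (ContinuousLinearMap.lsmul ℝ ℝ) μ :=
    φ.hasCompactSupport_normed.convolutionExists_left _ (φ.contDiff_normed (n := 0)).continuous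
      hAc.locallyIntegrable
  refine ⟨convolution (φ.normed μ) A (ContinuousLinearMap.lsmul ℝ ℝ) μ, ⟨convex_univ, ?_⟩, ?_, ?_⟩
  · intro x _ y _ a b ha hb hab
    simp only [convolution, ContinuousLinearMap.lsmul_apply]
    rw [← integral_smul, ← integral_smul, ← integral_add]
    rotate_left
    · exact (hex x).smul a
    · exact (hex y).smul b
    refine integral_mono (hex _) (((hex x).smul a).add ((hex y).smul b)) fun t => ?_
    have h1 := hA.2 (mem_univ (x - t)) (mem_univ (y - t)) ha hb hab
    have h2 : a • (x - t) + b • (y - t) = a • x + b • y - t := by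
      have : t = a • t + b • t := by rw [← add_smul, hab, one_smul]
      nth_rewrite 3 [this]
      rw [smul_sub, smul_sub]; abel
    rw [h2] at h1
    simp only [smul_eq_mul] at h1 ⊢
    have h3 := mul_le_mul_of_nonneg_left h1 (φ.nonneg_normed (μ := μ) t)
    linarith
  · exact φ.hasCompactSupport_normed.contDiff_convolution_left _ φ.contDiff_normed
      hAc.locallyIntegrable (n := 2)
  · intro x
    rw [← Real.dist_eq]
    refine φ.dist_normed_convolution_le hAc.aestronglyMeasurable fun y hy => ?_
    have h1 := hL.dist_le_mul y x
    have h2 : dist y x ≤ r := (mem_ball.mp hy).le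
    calc dist (A y) (A x) ≤ L * r := h1.trans (by gcongr)
      _ ≤ (L + 1) * r := by gcongr; linarith
      _ = δ := by rw [hr]; field_simp

/-- The image `∂A(K)` of `K` under the subdifferential of a function `A` on the whole space. -/
def subgradientImage (A : E → ℝ) (K : Set E) : Set E :=
  {p | ∃ x ∈ K, ∀ y, A x + inner ℝ p (y - x) ≤ A y}

/-- Regularized form of `measure_subgradientImage_le`. The function `h` is a smooth uniformly
convex approximation of `A + B`. The quadratic term `ε ‖x‖²` makes the touching points of `B`
strict, so that they persist under mollification; and it does not decrease `|∂B(K)|` because the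
inverse of `p ↦ p + 2 ε x`, `p ∈ ∂B(x)`, is a contraction. -/
lemma exists_approx_measure_subgradientImage_le (μ : Measure E) [μ.IsAddHaarMeasure]
    {A B : E → ℝ} (hA : ConvexOn ℝ univ A) (hB : ConvexOn ℝ univ B) {LA LB : NNReal}
    (hLA : LipschitzWith LA A) (hLB : LipschitzWith LB B) (K : Set E) {ε : ℝ} (hε : 0 < ε) :
    ∃ h : E → ℝ, (∀ x, |h x - (A x + B x)| ≤ ε * (‖x‖ ^ 2 + 1)) ∧
      μ (subgradientImage B K) ≤ μ (subgradientImage h (thickening ε K)) := by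
  set δ : ℝ := min (ε ^ 3 / 4) (ε / 2) with hδ
  have hδ0 : 0 < δ := by positivity
  obtain ⟨A', hA'c, hA'2, hA'⟩ := exists_contDiff_convexOn_approx hA hLA hδ0
  obtain ⟨B', hB'c, hB'2, hB'⟩ := exists_contDiff_convexOn_approx hB hLB hδ0
  obtain ⟨XA, MA, hXA, hMA, hMAp⟩ := exists_hessian_of_convexOn hA'c hA'2
  obtain ⟨XB, MB, hXB, hMB, hMBp⟩ := exists_hessian_of_convexOn hB'c hB'2
  set U := thickening ε K
  have hUm : MeasurableSet U := isOpen_thickening.measurableSet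
  set Xb : E → E := fun x => XB x + (2 * ε) • x
  set Mb : E → E →L[ℝ] E := fun x => MB x + (2 * ε) • ContinuousLinearMap.id ℝ E
  set Xh : E → E := fun x => Xb x + XA x
  have hgb : ∀ x, HasGradientAt (fun y => B' y + ε * ‖y‖ ^ 2) (Xb x) x := fun x => by
    have h1 := HasGradientAt.add (hXB x)
      (HasGradientAt.const_mul ε (hasGradientAt_norm_sq x))
    rwa [smul_smul, mul_comm ε 2] at h1
  have hMb : ∀ x, HasFDerivAt Xb (Mb x) x := fun x =>
    (hMB x).add ((hasFDerivAt_id x).const_smul (2 * ε))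
  have hMbp : ∀ x, (Mb x).IsPositive := fun x =>
    (hMBp x).add (ContinuousLinearMap.isPositive_id.smul_of_nonneg (by positivity))
  have hgA := fun x y => add_inner_le_of_convexOn hA'c (mem_univ x) (mem_univ y) (hXA x)
  have hgB := fun x y => add_inner_le_of_convexOn hB'c (mem_univ x) (mem_univ y) (hXB x)
  have hinj : Function.Injective Xh := by
    intro x y hxy
    have h1 := inner_sub_nonneg_of_subgradients (hgA x y) (hgA y x)
    have h2 := inner_sub_nonneg_of_subgradients (hgB x y) (hgB y x)
    have h3 : inner ℝ (Xh x - Xh y) (x - y) = inner ℝ (XA x - XA y) (x - y)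
        + inner ℝ (XB x - XB y) (x - y) + 2 * ε * ‖x - y‖ ^ 2 := by
      have : Xh x - Xh y = (XA x - XA y) + (XB x - XB y) + (2 * ε) • (x - y) := by
        simp only [Xh, Xb, smul_sub]; abel
      rw [this, inner_add_left, inner_add_left, real_inner_smul_left, real_inner_self_eq_norm_sq]
    rw [hxy, sub_self, inner_zero_left] at h3
    have h4 : ‖x - y‖ ^ 2 ≤ 0 := by
      by_contra hcon
      push Not at hcon
      have : 0 < 2 * ε * ‖x - y‖ ^ 2 := by positivity
      linarith
    have h5 : ‖x - y‖ = 0 := by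
      have := le_antisymm h4 (sq_nonneg _)
      exact pow_eq_zero_iff (two_ne_zero) |>.mp this
    exact sub_eq_zero.mp (norm_eq_zero.mp h5)
  refine ⟨fun x => B' x + ε * ‖x‖ ^ 2 + A' x, fun x => ?_, ?_⟩
  · have h1 := abs_le.mp (hA' x)
    have h2 := abs_le.mp (hB' x)
    have h3 : δ ≤ ε / 2 := min_le_right _ _
    have h4 : 0 ≤ ε * ‖x‖ ^ 2 := by positivity
    rw [abs_le]
    constructor <;> linarith [h1.1, h1.2, h2.1, h2.2]
  · set S : Set E := {q | ∃ p, ∃ x ∈ K, (∀ y, B x + inner ℝ p (y - x) ≤ B y) ∧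
      q = p + (2 * ε) • x}
    have hS : μ (subgradientImage B K) ≤ μ S := by
      have hch : ∀ q ∈ S, ∃ p, ∃ x ∈ K, (∀ y, B x + inner ℝ p (y - x) ≤ B y) ∧
        q = p + (2 * ε) • x := fun q hq => hq
      have hcontr : ∀ p x, (∀ y, B x + inner ℝ p (y - x) ≤ B y) → ∀ p' x',
          (∀ y, B x' + inner ℝ p' (y - x') ≤ B y) →
          ‖p - p'‖ ≤ ‖(p + (2 * ε) • x) - (p' + (2 * ε) • x')‖ := by
        intro p x hp p' x' hp'
        have h1 := inner_sub_nonneg_of_subgradients (hp x') (hp' x)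
        have h2 : (p + (2 * ε) • x) - (p' + (2 * ε) • x') = (p - p') + (2 * ε) • (x - x') := by
          rw [smul_sub]; abel
        refine (sq_le_sq₀ (norm_nonneg _) (norm_nonneg _)).mp ?_
        rw [h2, norm_add_sq_real, real_inner_smul_right]
        have : 0 ≤ 2 * (2 * ε * inner ℝ (p - p') (x - x')) := by positivity
        nlinarith [sq_nonneg ‖(2 * ε) • (x - x')‖]
      choose! g hg using hch
      have hLip : LipschitzOnWith 1 g S := by
        refine LipschitzOnWith.of_dist_le_mul fun q hq q' hq' => ?_
        obtain ⟨x, -, hx, hqx⟩ := hg q hq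
        obtain ⟨x', -, hx', hqx'⟩ := hg q' hq'
        rw [NNReal.coe_one, one_mul, dist_eq_norm, dist_eq_norm]
        calc ‖g q - g q'‖ ≤ ‖(g q + (2 * ε) • x) - (g q' + (2 * ε) • x')‖ :=
              hcontr _ _ hx _ _ hx'
          _ = ‖q - q'‖ := by rw [← hqx, ← hqx']
      have hsub : subgradientImage B K ⊆ g '' S := by
        rintro p ⟨x, hxK, hx⟩
        have hq : p + (2 * ε) • x ∈ S := ⟨p, x, hxK, hx, rfl⟩
        refine ⟨_, hq, ?_⟩
        obtain ⟨x', -, hx', hqx'⟩ := hg _ hq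
        have := hcontr _ _ hx' _ _ hx
        rw [← hqx', sub_self, norm_zero] at this
        exact sub_eq_zero.mp (norm_le_zero_iff.mp this)
      have := addHaar_image_le_of_lipschitzOnWith μ hLip
      rw [ENNReal.coe_one, one_pow, one_mul] at this
      exact (measure_mono hsub).trans this
    have hSb : S ⊆ Xb '' U := by
      rintro _ ⟨p, x, hxK, hx, rfl⟩
      set ψ : E → ℝ := fun y => B' y + ε * ‖y‖ ^ 2 - inner ℝ (p + (2 * ε) • x) y
      have hψ : ∀ y, ψ y = (B' y - B y) + (B y - inner ℝ p y) + (ε * ‖y - x‖ ^ 2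
          - ε * ‖x‖ ^ 2) := fun y => by
        simp only [ψ]
        rw [norm_sub_sq_real, inner_add_left, real_inner_smul_left, real_inner_comm x y]
        ring
      have hψc : Continuous ψ := by
        have := hB'2.continuous
        fun_prop
      obtain ⟨y, hy, hmin⟩ := (isCompact_closedBall x ε).exists_isMinOn
        ⟨x, mem_closedBall_self hε.le⟩ hψc.continuousOn
      have hyx : ‖y - x‖ < ε := by
        have h1 : ψ y ≤ ψ x := hmin (mem_closedBall_self hε.le)
        rw [hψ, hψ, sub_self, norm_zero] at h1
        have h2 := hx y
        rw [inner_sub_right] at h2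
        have h3 := abs_le.mp (hB' x)
        have h4 := abs_le.mp (hB' y)
        have h5 : δ ≤ ε ^ 3 / 4 := min_le_left _ _
        have h6 : ε * ‖y - x‖ ^ 2 ≤ ε ^ 3 / 2 := by linarith [h3.1, h3.2, h4.1, h4.2]
        have h7 : ‖y - x‖ ^ 2 < ε ^ 2 := by
          have : ε * ‖y - x‖ ^ 2 < ε * ε ^ 2 := by
            have : 0 < ε ^ 3 := by positivity
            nlinarith
          exact lt_of_mul_lt_mul_left this hε.le
        exact lt_of_pow_lt_pow_left₀ 2 hε.le h7
      have hyb : y ∈ ball x ε := by rwa [mem_ball, dist_eq_norm]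
      refine ⟨y, mem_thickening_iff.mpr ⟨x, hxK, mem_ball.mp hyb⟩, ?_⟩
      refine HasGradientAt.eq_of_isLocalMin (hgb y) ?_
      exact hmin.isLocalMin (mem_of_superset (isOpen_ball.mem_nhds hyb) ball_subset_closedBall)
    have hsub : Xh '' U ⊆ subgradientImage (fun x => B' x + ε * ‖x‖ ^ 2 + A' x) U := by
      rintro _ ⟨x, hx, rfl⟩
      refine ⟨x, hx, fun y => ?_⟩
      have h1 := hgA x y
      have h2 := hgB x y
      have h3 : inner ℝ (Xh x) (y - x) = inner ℝ (XA x) (y - x) + inner ℝ (XB x) (y - x)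
          + 2 * ε * inner ℝ x (y - x) := by
        simp only [Xh, Xb]
        rw [inner_add_left, inner_add_left, real_inner_smul_left]; ring
      have h4 : ‖y‖ ^ 2 = ‖x‖ ^ 2 + 2 * inner ℝ x (y - x) + ‖y - x‖ ^ 2 := by
        rw [← norm_add_sq_real, add_sub_cancel]
      have h5 : 0 ≤ ε * ‖y - x‖ ^ 2 := by positivity
      change B' x + ε * ‖x‖ ^ 2 + A' x + inner ℝ (Xh x) (y - x) ≤ B' y + ε * ‖y‖ ^ 2 + A' y
      rw [h3, h4]
      linarith
    calc μ (subgradientImage B K) ≤ μ S := hS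
      _ ≤ μ (Xb '' U) := measure_mono hSb
      _ ≤ ∫⁻ x in U, ENNReal.ofReal |(Mb x).det| ∂μ :=
          addHaar_image_le_lintegral_abs_det_fderiv μ hUm fun x _ => (hMb x).hasFDerivWithinAt
      _ ≤ ∫⁻ x in U, ENNReal.ofReal |(Mb x + MA x).det| ∂μ := by
          refine lintegral_mono fun x => ENNReal.ofReal_le_ofReal ?_
          rw [abs_of_nonneg (IsPositive.det_nonneg (hMbp x)),
            abs_of_nonneg (IsPositive.det_nonneg ((hMbp x).add (hMAp x)))]
          exact det_le_det_add (hMbp x) (hMAp x)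
      _ = μ (Xh '' U) := lintegral_abs_det_fderiv_eq_addHaar_image μ hUm
          (fun x _ => ((hMb x).add (hMA x)).hasFDerivWithinAt) hinj.injOn
      _ ≤ _ := measure_mono hsub

/-- Adding a convex function does not decrease the Monge-Ampère measure: `|∂B(K)| ≤ |∂(A + B)(K)|`.
For smooth functions this is the monotonicity of the determinant; the general case follows by
approximation. -/
lemma measure_subgradientImage_le (μ : Measure E) [μ.IsAddHaarMeasure]
    {A B : E → ℝ} (hA : ConvexOn ℝ univ A) (hB : ConvexOn ℝ univ B) {LA LB : NNReal}
    (hLA : LipschitzWith LA A) (hLB : LipschitzWith LB B) {K : Set E} (hK : IsCompact K) :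
    μ (subgradientImage B K) ≤ μ (subgradientImage (fun x => A x + B x) K) := by
  set ε : ℕ → ℝ := fun k => 1 / ((k : ℝ) + 1)
  have hε0 : ∀ k, 0 < ε k := fun k => Nat.one_div_pos_of_nat
  have hε1 : ∀ k, ε k ≤ 1 := fun k => by
    simp only [ε]
    rw [div_le_one (by positivity)]
    linarith [Nat.cast_nonneg (α := ℝ) k]
  have hεlim : Tendsto ε atTop (𝓝 0) := tendsto_one_div_add_atTop_nhds_zero_nat
  choose h hh hhμ using fun k =>
    exists_approx_measure_subgradientImage_le μ hA hB hLA hLB K (hε0 k)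
  set H : E → ℝ := fun x => A x + B x
  have hH : LipschitzWith (LA + LB) H := hLA.add hLB
  obtain ⟨R, hR0, hR⟩ : ∃ R : ℝ, 0 ≤ R ∧ thickening 1 K ⊆ closedBall 0 R := by
    obtain ⟨R, hR⟩ := (hK.isBounded.thickening (δ := 1)).subset_closedBall 0
    exact ⟨max R 0, le_max_right _ _, hR.trans (closedBall_subset_closedBall (le_max_left _ _))⟩
  have hthick : ∀ k, thickening (ε k) K ⊆ closedBall 0 R := fun k =>
    (thickening_mono (hε1 k) K).trans hR
  have hbound : ∀ k, subgradientImage (h k) (thickening (ε k) K)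
      ⊆ closedBall 0 ((LA + LB : NNReal) + 2 * ((R + 1) ^ 2 + 1)) := by
    rintro k ξ ⟨x, hx, hξ⟩
    rw [mem_closedBall_zero_iff]
    rcases eq_or_ne ξ 0 with rfl | hξ0
    · rw [norm_zero]; positivity
    have hxR : ‖x‖ ≤ R := mem_closedBall_zero_iff.mp (hthick k hx)
    have hn : 0 < ‖ξ‖ := norm_pos_iff.mpr hξ0
    set e : E := ‖ξ‖⁻¹ • ξ
    have he : ‖e‖ = 1 := by
      simp only [e]; rw [norm_smul, norm_inv, norm_norm, inv_mul_cancel₀ hn.ne']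
    have h1 := hξ (x + e)
    have h2 : inner ℝ ξ (x + e - x) = ‖ξ‖ := by
      rw [add_sub_cancel_left, real_inner_smul_right, real_inner_self_eq_norm_sq]
      field_simp
    have h3 := hH.dist_le_mul (x + e) x
    rw [dist_eq_norm (x + e), add_sub_cancel_left, he, mul_one, Real.dist_eq] at h3
    have h4 : ∀ y : E, ‖y‖ ≤ R + 1 → |h k y - H y| ≤ (R + 1) ^ 2 + 1 := fun y hy => by
      calc |h k y - H y| ≤ ε k * (‖y‖ ^ 2 + 1) := hh k y
        _ ≤ 1 * ((R + 1) ^ 2 + 1) := by gcongr; exact hε1 k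
        _ = _ := one_mul _
    have h5 := abs_le.mp (h4 x (by linarith))
    have h6 := abs_le.mp (h4 (x + e) ((norm_add_le _ _).trans (by rw [he]; linarith)))
    have h7 := abs_le.mp h3
    rw [h2] at h1
    linarith [h5.1, h6.2, h7.2]
  refine (le_measure_limitPoints μ isBounded_closedBall hbound hhμ).trans (measure_mono ?_)
  rintro ξ ⟨k, q, hk, hq, hqξ⟩
  choose x hx hsub using hq
  obtain ⟨x₀, -, φ, hφ, hxφ⟩ := (isCompact_closedBall (0 : E) R).tendsto_subseq
    fun j => hthick (k j) (hx j)
  have hεφ : Tendsto (fun j => ε (k (φ j))) atTop (𝓝 0) :=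
    hεlim.comp (hk.comp hφ.tendsto_atTop)
  have hqφ : Tendsto (fun j => q (φ j)) atTop (𝓝 ξ) := hqξ.comp hφ.tendsto_atTop
  have hx₀ : x₀ ∈ K := by
    have hne : K.Nonempty := by
      obtain ⟨z, hz, -⟩ := mem_thickening_iff.mp (hx 0)
      exact ⟨z, hz⟩
    rw [hK.isClosed.mem_iff_infDist_zero hne]
    refine le_antisymm ?_ infDist_nonneg
    refine le_of_tendsto_of_tendsto' (((continuous_infDist_pt K).tendsto x₀).comp hxφ) hεφ
      fun j => ?_
    obtain ⟨z, hz, hd⟩ := mem_thickening_iff.mp (hx (φ j))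
    exact (infDist_le_dist_of_mem hz).trans hd.le
  refine ⟨x₀, hx₀, fun y => ?_⟩
  have h1 : ∀ j, H (x (φ j)) - ε (k (φ j)) * (‖x (φ j)‖ ^ 2 + 1)
      + inner ℝ (q (φ j)) (y - x (φ j)) ≤ H y + ε (k (φ j)) * (‖y‖ ^ 2 + 1) := fun j => by
    have h2 := abs_le.mp (hh (k (φ j)) (x (φ j)))
    have h3 := abs_le.mp (hh (k (φ j)) y)
    have h4 := hsub (φ j) y
    linarith [h2.1, h3.2]
  have hxφ' : Tendsto (fun j => x (φ j)) atTop (𝓝 x₀) := hxφ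
  have hl : Tendsto (fun j => H (x (φ j)) - ε (k (φ j)) * (‖x (φ j)‖ ^ 2 + 1)
      + inner ℝ (q (φ j)) (y - x (φ j))) atTop
      (𝓝 (H x₀ - 0 * (‖x₀‖ ^ 2 + 1) + inner ℝ ξ (y - x₀))) :=
    (((hH.continuous.tendsto x₀).comp hxφ').sub
      (hεφ.mul (((hxφ'.norm).pow 2).add_const 1))).add (hqφ.inner (tendsto_const_nhds.sub hxφ'))
  have hr : Tendsto (fun j => H y + ε (k (φ j)) * (‖y‖ ^ 2 + 1)) atTop
      (𝓝 (H y + 0 * (‖y‖ ^ 2 + 1))) := tendsto_const_nhds.add (hεφ.mul_const _)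
  have := le_of_tendsto_of_tendsto' hl hr h1
  simpa using this

end

section

variable {E : Type*} [NormedAddCommGroup E] [InnerProductSpace ℝ E] [FiniteDimensional ℝ E]

/-! ### Slopes of a difference along its contact set -/

omit [FiniteDimensional ℝ E] in
/-- The upper envelope of the affine functions of slope `q x` through `(x, c x)`, `x ∈ K`. -/
lemma exists_upper_envelope {K : Set E} (hK : IsCompact K) (hne : K.Nonempty) {c : E → ℝ}
    {q : E → E} (hc : ContinuousOn c K) (hq : ContinuousOn q K) :
    ∃ (G : E → ℝ) (L : NNReal), ConvexOn ℝ univ G ∧ LipschitzWith L G ∧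
      (∀ x ∈ K, ∀ y, c x + inner ℝ (q x) (y - x) ≤ G y) ∧
      ∀ y t, (∀ x ∈ K, c x + inner ℝ (q x) (y - x) ≤ t) → G y ≤ t := by
  obtain ⟨L, hL⟩ := (hK.image_of_continuousOn hq).isBounded.exists_norm_le
  have hcont : ∀ y, ContinuousOn (fun x => c x + inner ℝ (q x) (y - x)) K := fun y =>
    hc.add (hq.inner (continuousOn_const.sub continuousOn_id))
  have hlub : ∀ y, ∃ t, (∀ x ∈ K, c x + inner ℝ (q x) (y - x) ≤ t) ∧
      ∃ x ∈ K, t = c x + inner ℝ (q x) (y - x) := fun y => by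
    obtain ⟨x, hx, hmax⟩ := hK.exists_isMaxOn hne (hcont y)
    exact ⟨_, fun z hz => hmax hz, x, hx, rfl⟩
  choose G hG x₁ hx₁ hGx using hlub
  refine ⟨G, L.toNNReal, ⟨convex_univ, ?_⟩, LipschitzWith.of_le_add_mul _ ?_,
    fun x hx y => hG y x hx, fun y t ht => ?_⟩
  · intro y _ z _ a b ha hb hab
    set x := x₁ (a • y + b • z)
    have h1 := hG y x (hx₁ _)
    have h2 := hG z x (hx₁ _)
    have h3 : a • y + b • z - x = a • (y - x) + b • (z - x) := by
      have : x = a • x + b • x := by rw [← add_smul, hab, one_smul]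
      nth_rewrite 1 [this]
      rw [smul_sub, smul_sub]; abel
    rw [hGx (a • y + b • z), h3, inner_add_right, real_inner_smul_right, real_inner_smul_right,
      smul_eq_mul, smul_eq_mul]
    calc c x + (a * inner ℝ (q x) (y - x) + b * inner ℝ (q x) (z - x))
        = a * (c x + inner ℝ (q x) (y - x)) + b * (c x + inner ℝ (q x) (z - x)) := by
          linear_combination (- c x) * hab
      _ ≤ a * G y + b * G z := by gcongr
  · intro y z
    have h1 := hG z (x₁ y) (hx₁ y)
    have h2 : inner ℝ (q (x₁ y)) (y - x₁ y)
        = inner ℝ (q (x₁ y)) (z - x₁ y) + inner ℝ (q (x₁ y)) (y - z) := by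
      rw [← inner_add_right]; congr 1; abel
    have h3 : inner ℝ (q (x₁ y)) (y - z) ≤ L.toNNReal * dist y z := by
      rw [dist_eq_norm]
      refine (real_inner_le_norm _ _).trans ?_
      gcongr
      exact (hL _ (mem_image_of_mem q (hx₁ y))).trans (Real.le_coe_toNNReal L)
    rw [hGx y, h2]
    linarith
  · rw [hGx y]
    exact ht _ (hx₁ y)

variable [MeasurableSpace E] [BorelSpace E]

/-- If `A` and `B` have supporting slopes `Y` and `Q` along `K`, and `A + B` has gradient `X`
there, then `|Q(K)| ≤ |X(K)|`: replace `A` and `B` by the upper envelopes of their supporting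
planes, which lie below them, and apply `measure_subgradientImage_le`. -/
lemma measure_image_slopes_le (μ : Measure E) [μ.IsAddHaarMeasure] {A B : E → ℝ}
    {X Y Q : E → E} {K S : Set E} (hK : IsCompact K) (hS : IsOpen S) (hKS : K ⊆ S)
    (hA : ContinuousOn A K) (hB : ContinuousOn B K) (hY : ContinuousOn Y K)
    (hQ : ContinuousOn Q K)
    (hAY : ∀ x ∈ K, ∀ y ∈ S, A x + inner ℝ (Y x) (y - x) ≤ A y)
    (hBQ : ∀ x ∈ K, ∀ y ∈ S, B x + inner ℝ (Q x) (y - x) ≤ B y)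
    (hX : ∀ x ∈ K, HasGradientAt (fun y => A y + B y) (X x) x) :
    μ (Q '' K) ≤ μ (X '' K) := by
  rcases K.eq_empty_or_nonempty with rfl | hne
  · simp
  obtain ⟨A', LA, hA'c, hA'L, hA'1, hA'2⟩ := exists_upper_envelope hK hne hA hY
  obtain ⟨B', LB, hB'c, hB'L, hB'1, hB'2⟩ := exists_upper_envelope hK hne hB hQ
  have hA'le : ∀ y ∈ S, A' y ≤ A y := fun y hy => hA'2 y _ fun x hx => hAY x hx y hy
  have hB'le : ∀ y ∈ S, B' y ≤ B y := fun y hy => hB'2 y _ fun x hx => hBQ x hx y hy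
  have hA'eq : ∀ x ∈ K, A x ≤ A' x := fun x hx => by simpa using hA'1 x hx x
  have hB'eq : ∀ x ∈ K, B x ≤ B' x := fun x hx => by simpa using hB'1 x hx x
  calc μ (Q '' K) ≤ μ (subgradientImage B' K) := by
        refine measure_mono ?_
        rintro _ ⟨x, hx, rfl⟩
        refine ⟨x, hx, fun y => ?_⟩
        linarith [hB'1 x hx y, hB'le x (hKS hx)]
    _ ≤ μ (subgradientImage (fun x => A' x + B' x) K) :=
        measure_subgradientImage_le μ hA'c hB'c hA'L hB'L hK
    _ ≤ μ (X '' K) := by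
        refine measure_mono ?_
        rintro p ⟨x, hx, hp⟩
        refine ⟨x, hx, HasGradientAt.eq_of_eventually_le (hX x hx) ?_⟩
        filter_upwards [hS.mem_nhds (hKS hx)] with y hy
        linarith [hp y, hA'le y hy, hB'le y hy, hA'eq x hx, hB'eq x hx]

/-- Lusin's property (N) for a map `Q` whose images of compact sets are bounded in measure. -/
lemma measure_image_eq_zero_of_compact_bound (μ : Measure E) [μ.IsAddHaarMeasure] {Q : E → E}
    {C N : Set E} (hC : IsCompact C) (hN : μ N = 0) {c : ℝ≥0∞} (hc : c ≠ ∞)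
    (hQ : ∀ K ⊆ C, IsCompact K → μ (Q '' K) ≤ c * μ K) : μ (Q '' (C ∩ N)) = 0 := by
  by_contra hne
  obtain ⟨ε, hε0, hε⟩ : ∃ ε, 0 < ε ∧ c * ε < μ (Q '' (C ∩ N)) := by
    have h1 : Tendsto (fun ε => c * ε) (𝓝[>] (0 : ℝ≥0∞)) (𝓝 (c * 0)) :=
      (ENNReal.Tendsto.const_mul tendsto_id (Or.inr hc)).mono_left nhdsWithin_le_nhds
    rw [mul_zero] at h1
    have h2 := h1.eventually (gt_mem_nhds (pos_iff_ne_zero.mpr hne))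
    obtain ⟨ε, h3, h4⟩ := (h2.and self_mem_nhdsWithin).exists
    exact ⟨ε, h4, h3⟩
  obtain ⟨O, hNO, hO, hμO⟩ := N.exists_isOpen_lt_of_lt ε (by rw [hN]; exact hε0)
  obtain ⟨F, hF, -, hFO, hFm⟩ := hO.exists_iUnion_isClosed
  have h1 : Q '' (C ∩ N) ⊆ ⋃ j, Q '' (C ∩ F j) := by
    rw [← image_iUnion, ← inter_iUnion, hFO]
    exact image_mono (inter_subset_inter_right _ hNO)
  have h2 : μ (⋃ j, Q '' (C ∩ F j)) ≤ c * ε := by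
    rw [Monotone.measure_iUnion fun i j hij => image_mono (inter_subset_inter_right _ (hFm hij))]
    refine iSup_le fun j => ?_
    calc μ (Q '' (C ∩ F j)) ≤ c * μ (C ∩ F j) := hQ _ inter_subset_left (hC.inter_right (hF j))
      _ ≤ c * ε := by
        gcongr
        refine (measure_mono (inter_subset_right.trans ?_)).trans hμO.le
        rw [← hFO]
        exact subset_iUnion F j
  exact ((measure_mono h1).trans h2).not_gt hε

/-! ### Densities of image measures -/

lemma ae_abs_det_fderiv_le (μ : Measure E) [μ.IsAddHaarMeasure] {X : E → E} {S : Set E}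
    (hS : MeasurableSet S) (hinj : InjOn X S) {ρ : E → ℝ≥0∞}
    (hρ : ∀ T ⊆ S, MeasurableSet T → μ (X '' T) ≤ ∫⁻ x in T, ρ x ∂μ) :
    ∀ᵐ x ∂μ, x ∈ S → DifferentiableAt ℝ X x → ENNReal.ofReal |(fderiv ℝ X x).det| ≤ ρ x := by
  set D := S ∩ {x | DifferentiableAt ℝ X x}
  have hD : MeasurableSet D := hS.inter (measurableSet_of_differentiableAt ℝ X)
  have hmeas : Measurable fun x => ENNReal.ofReal |(fderiv ℝ X x).det| :=
    (ContinuousLinearMap.continuous_det.measurable.comp (measurable_fderiv ℝ X)).abs.ennreal_ofReal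
  have h := ae_le_of_forall_setLIntegral_le_of_sigmaFinite (μ := μ) (g := ρ)
    (hmeas.indicator hD) fun s hs _ => by
      rw [setLIntegral_indicator hD, lintegral_abs_det_fderiv_eq_addHaar_image μ (hD.inter hs)
        (fun x hx => hx.1.2.hasFDerivAt.hasFDerivWithinAt)
        (hinj.mono fun x hx => hx.1.1)]
      exact (hρ _ (fun x hx => hx.1.1) (hD.inter hs)).trans
        (lintegral_mono_set inter_subset_right)
  filter_upwards [h] with x hx hxS hxd
  rwa [indicator_of_mem (show x ∈ D from ⟨hxS, hxd⟩)] at hx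

lemma ae_le_abs_det_fderiv (μ : Measure E) [μ.IsAddHaarMeasure] {Y : E → E} {S : Set E}
    (hS : MeasurableSet S) {ρ : E → ℝ≥0∞} (hρm : AEMeasurable ρ (μ.restrict S))
    (hρ : ∀ T ⊆ S, MeasurableSet T → ∫⁻ x in T, ρ x ∂μ ≤ μ (Y '' T)) :
    ∀ᵐ x ∂μ, x ∈ S → DifferentiableAt ℝ Y x → ρ x ≤ ENNReal.ofReal |(fderiv ℝ Y x).det| := by
  set D := S ∩ {x | DifferentiableAt ℝ Y x}
  have hD : MeasurableSet D := hS.inter (measurableSet_of_differentiableAt ℝ Y)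
  have h := ae_le_of_forall_setLIntegral_le_of_sigmaFinite₀ (μ := μ)
    (g := fun x => ENNReal.ofReal |(fderiv ℝ Y x).det|)
    ((aemeasurable_indicator_iff hD).mpr (hρm.mono_measure
      (Measure.restrict_mono inter_subset_left le_rfl))) fun s hs _ => by
      rw [setLIntegral_indicator hD]
      refine (hρ _ (fun x hx => hx.1.1) (hD.inter hs)).trans ?_
      exact (addHaar_image_le_lintegral_abs_det_fderiv μ (hD.inter hs)
        (fun x hx => hx.1.2.hasFDerivAt.hasFDerivWithinAt)).trans
        (lintegral_mono_set inter_subset_right)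
  filter_upwards [h] with x hx hxS hxd
  rwa [indicator_of_mem (show x ∈ D from ⟨hxS, hxd⟩)] at hx

/-! ### The measure estimate for contact sets -/

/-- Let `C` be a set of points where `u - (1 - a) v` has a supporting plane; its slope there is
`∇u - (1 - a) ∇v`. If the density of `u` exceeds that of `v` by a factor at most `1 + M a` on
`C`, then the set of these slopes has measure at most `const · a ^ N |C|`, with a constant that
does not depend on `a`. Almost everywhere on `C` both gradients are differentiable and
`det_sub_le` applies to their derivatives; on the remaining null subset of `C` the slopes are
controlled by `measure_image_slopes_le`. -/
lemma measure_contact_slopes_le (μ : Measure E) [μ.IsAddHaarMeasure] {S C : Set E}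
    {u v ρu ρv : E → ℝ} {X Y : E → E} {a M Lam : ℝ} (hS : IsOpen S)
    (hu : ∀ x ∈ S, HasGradientAt u (X x) x) (hv : ∀ x ∈ S, HasGradientAt v (Y x) x)
    (hXc : ContinuousOn X S) (hYc : ContinuousOn Y S)
    (husub : ∀ x ∈ S, ∀ y ∈ S, u x + inner ℝ (X x) (y - x) ≤ u y)
    (hvsub : ∀ x ∈ S, ∀ y ∈ S, v x + inner ℝ (Y x) (y - x) ≤ v y)
    (hXinj : InjOn X S)
    (hρu : ∀ T ⊆ S, MeasurableSet T → μ (X '' T) ≤ ∫⁻ x in T, ENNReal.ofReal (ρu x) ∂μ)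
    (hρv : ∀ T ⊆ S, MeasurableSet T → ∫⁻ x in T, ENNReal.ofReal (ρv x) ∂μ ≤ μ (Y '' T))
    (hρvm : AEMeasurable ρv (μ.restrict S)) (hρv0 : ∀ᵐ x ∂μ, x ∈ S → 0 < ρv x)
    (hLam : ∀ᵐ x ∂μ, x ∈ S → ρu x ≤ Lam)
    (hC : IsCompact C) (hCS : C ⊆ S) (ha : 0 < a) (ha' : a ≤ 1 / 2) (hM : 0 ≤ M)
    (hρ : ∀ᵐ x ∂μ, x ∈ C → ρu x ≤ (1 + M * a) * ρv x)
    (hcontact : ∀ x ∈ C, ∀ y ∈ S,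
      u x - (1 - a) * v x + inner ℝ (X x - (1 - a) • Y x) (y - x) ≤ u y - (1 - a) * v y) :
    μ ((fun x => X x - (1 - a) • Y x) '' C)
      ≤ ENNReal.ofReal (2 ^ Module.finrank ℝ E * Lam *
        (2 ^ Module.finrank ℝ E * (M + Module.finrank ℝ E) * a) ^ Module.finrank ℝ E) * μ C := by
  set N := Module.finrank ℝ E
  set Q : E → E := fun x => X x - (1 - a) • Y x with hQdef
  have h1a : (0 : ℝ) ≤ 1 - a := by linarith
  have hucont : ContinuousOn u S := fun x hx => (hu x hx).continuousAt.continuousWithinAt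
  have hvcont : ContinuousOn v S := fun x hx => (hv x hx).continuousAt.continuousWithinAt
  have hQc : ContinuousOn Q S := hXc.sub (hYc.const_smul _)
  have hmonoX : ∀ x ∈ S, ∀ y ∈ S, 0 ≤ inner ℝ (X x - X y) (x - y) := fun x hx y hy =>
    inner_sub_nonneg_of_subgradients (husub x hx y hy) (husub y hy x hx)
  have hmonoY : ∀ x ∈ S, ∀ y ∈ S, 0 ≤ inner ℝ (Y x - Y y) (x - y) := fun x hx y hy =>
    inner_sub_nonneg_of_subgradients (hvsub x hx y hy) (hvsub y hy x hx)
  set G : Set E := {x | DifferentiableAt ℝ X x ∧ DifferentiableAt ℝ Y x}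
  have hG : MeasurableSet G :=
    (measurableSet_of_differentiableAt ℝ X).inter (measurableSet_of_differentiableAt ℝ Y)
  have haeX := ae_differentiableAt_of_monotone μ hS hXc hmonoX
  have haeY := ae_differentiableAt_of_monotone μ hS hYc hmonoY
  have hnull : μ (S \ G) = 0 := by
    refine measure_eq_zero_iff_ae_notMem.mpr ?_
    filter_upwards [haeX, haeY] with x h1 h2 h3
    exact h3.2 ⟨h1 h3.1, h2 h3.1⟩
  have hbad : μ (Q '' (C ∩ (S \ G))) = 0 := by
    refine measure_image_eq_zero_of_compact_bound μ hC hnull (c := ENNReal.ofReal Lam)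
      ENNReal.ofReal_ne_top fun K hKC hK => ?_
    have hKS := hKC.trans hCS
    calc μ (Q '' K) ≤ μ (X '' K) := by
          refine measure_image_slopes_le μ hK hS hKS (A := fun y => (1 - a) * v y)
            (B := fun y => u y - (1 - a) * v y) (Y := fun x => (1 - a) • Y x)
            ((hvcont.mono hKS).const_mul _)
            ((hucont.sub (hvcont.const_mul _)).mono hKS)
            ((hYc.mono hKS).const_smul _) (hQc.mono hKS) ?_
            (fun x hx y hy => hcontact x (hKC hx) y hy) ?_
          · intro x hx y hy
            rw [real_inner_smul_left, ← mul_add]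
            exact mul_le_mul_of_nonneg_left (hvsub x (hKS hx) y hy) h1a
          · intro x hx
            simpa using hu x (hKS hx)
      _ ≤ ∫⁻ x in K, ENNReal.ofReal (ρu x) ∂μ := hρu K hKS hK.measurableSet
      _ ≤ ∫⁻ _ in K, ENNReal.ofReal Lam ∂μ := by
          refine setLIntegral_mono_ae measurable_const.aemeasurable ?_
          filter_upwards [hLam] with x hx hxK
          exact ENNReal.ofReal_le_ofReal (hx (hKS hxK))
      _ = ENNReal.ofReal Lam * μ K := setLIntegral_const _ _
  have hdetX := ae_abs_det_fderiv_le μ hS.measurableSet hXinj hρu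
  have hdetY := ae_le_abs_det_fderiv μ hS.measurableSet hρvm.ennreal_ofReal hρv
  set k : ℝ := 2 ^ N * Lam * (2 ^ N * (M + N) * a) ^ N
  have hgood : μ (Q '' (C ∩ G)) ≤ ENNReal.ofReal k * μ C := by
    calc μ (Q '' (C ∩ G))
        ≤ ∫⁻ x in C ∩ G, ENNReal.ofReal |(fderiv ℝ X x - (1 - a) • fderiv ℝ Y x).det| ∂μ :=
          addHaar_image_le_lintegral_abs_det_fderiv μ (hC.measurableSet.inter hG) fun x hx =>
            (hx.2.1.hasFDerivAt.sub (hx.2.2.hasFDerivAt.const_smul _)).hasFDerivWithinAt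
      _ ≤ ∫⁻ _ in C ∩ G, ENNReal.ofReal k ∂μ := by
          refine setLIntegral_mono_ae measurable_const.aemeasurable ?_
          filter_upwards [hdetX, hdetY, hρv0, hLam, hρ] with x h1 h2 h3 h4 h5 hx
          have hxS : x ∈ S := hCS hx.1
          have hSx := hS.mem_nhds hxS
          have hMX := hx.2.1.hasFDerivAt
          have hMY := hx.2.2.hasFDerivAt
          set DX := fderiv ℝ X x
          set DY := fderiv ℝ Y x
          have hDY : DY.IsPositive := by
            refine isPositive_of_isLocalMin (φ := fun y => v y - inner ℝ (Y x) y)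
              (X := fun y => Y y - Y x) (x := x) ?_ (hMY.sub_const _) ?_
            · filter_upwards [hSx] with y hy
              exact HasGradientAt.sub (hv y hy) (hasGradientAt_inner _ _)
            · filter_upwards [hSx] with y hy
              have := hvsub x hxS y hy
              rw [inner_sub_right] at this
              linarith
          have hDQ : (DX - (1 - a) • DY).IsPositive := by
            refine isPositive_of_isLocalMin
              (φ := fun y => (u y - (1 - a) * v y) - inner ℝ (Q x) y)
              (X := fun y => Q y - Q x) (x := x) ?_
              ((hMX.sub (hMY.const_smul _)).sub_const _) ?_
            · filter_upwards [hSx] with y hy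
              exact HasGradientAt.sub (HasGradientAt.sub (hu y hy)
                (HasGradientAt.const_mul _ (hv y hy))) (hasGradientAt_inner _ _)
            · filter_upwards [hSx] with y hy
              have := hcontact x hx.1 y hy
              rw [inner_sub_right] at this
              linarith
          have hDX : DX = (1 - a) • DY + (DX - (1 - a) • DY) := by abel
          have hDX0 : 0 ≤ DX.det := by
            rw [hDX]
            exact IsPositive.det_nonneg ((hDY.smul_of_nonneg h1a).add hDQ)
          have h2' := h2 hxS hx.2.2
          have h1' := h1 hxS hx.2.1
          rw [abs_of_nonneg (IsPositive.det_nonneg hDY)] at h2'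
          rw [abs_of_nonneg hDX0] at h1'
          have hρv' : ρv x ≤ DY.det :=
            (ENNReal.ofReal_le_ofReal_iff (IsPositive.det_nonneg hDY)).mp h2'
          have hDYpos : 0 < DY.det := (h3 hxS).trans_le hρv'
          have hDYle : DY.det ≤ 2 ^ N * DX.det := by
            have h6 : ((1 - a) • DY).det = (1 - a) ^ N * DY.det := by
              simp only [ContinuousLinearMap.det, ContinuousLinearMap.toLinearMap_smul,
                LinearMap.det_smul]
              rfl
            have h7 : ((1 - a) • DY).det ≤ DX.det := by
              conv_rhs => rw [hDX]
              exact det_le_det_add (hDY.smul_of_nonneg h1a) hDQ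
            rw [h6] at h7
            have h8 : (1 / 2 : ℝ) ^ N ≤ (1 - a) ^ N := by gcongr; linarith
            calc DY.det = 2 ^ N * ((1 / 2 : ℝ) ^ N * DY.det) := by
                  rw [← mul_assoc, ← mul_pow]; norm_num
              _ ≤ 2 ^ N * ((1 - a) ^ N * DY.det) := by gcongr
              _ ≤ 2 ^ N * DX.det := by gcongr
          have hDXpos : 0 < DX.det := by
            by_contra hcon
            have : DX.det = 0 := le_antisymm (not_lt.mp hcon) hDX0
            rw [this, mul_zero] at hDYle
            linarith
          have hρupos : 0 < ρu x := by
            by_contra hcon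
            rw [ENNReal.ofReal_of_nonpos (not_lt.mp hcon), nonpos_iff_eq_zero,
              ENNReal.ofReal_eq_zero] at h1'
            linarith
          have hDXle : DX.det ≤ ρu x := (ENNReal.ofReal_le_ofReal_iff hρupos.le).mp h1'
          have hdet : DX.det ≤ (1 + M * a) * DY.det := by
            calc DX.det ≤ (1 + M * a) * ρv x := hDXle.trans (h5 hx.1)
              _ ≤ (1 + M * a) * DY.det := by gcongr
          refine ENNReal.ofReal_le_ofReal ?_
          rw [abs_of_nonneg (IsPositive.det_nonneg hDQ)]
          calc (DX - (1 - a) • DY).det ≤ DY.det * (2 ^ N * (M + N) * a) ^ N :=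
                det_sub_le ha ha' hDY hDYpos hDQ hdet
            _ ≤ (2 ^ N * Lam) * (2 ^ N * (M + N) * a) ^ N := by
                gcongr
                exact hDYle.trans (by gcongr; exact hDXle.trans (h4 hxS))
      _ = ENNReal.ofReal k * μ (C ∩ G) := setLIntegral_const _ _
      _ ≤ ENNReal.ofReal k * μ C := by gcongr; exact inter_subset_left
  calc μ (Q '' C) ≤ μ (Q '' (C ∩ G) ∪ Q '' (C ∩ (S \ G))) := by
        refine measure_mono ?_
        rw [← image_union]
        refine image_mono fun x hx => ?_
        by_cases hxG : x ∈ G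
        · exact Or.inl ⟨hx, hxG⟩
        · exact Or.inr ⟨hx, hCS hx, hxG⟩
    _ ≤ μ (Q '' (C ∩ G)) + μ (Q '' (C ∩ (S \ G))) := measure_union_le _ _
    _ ≤ ENNReal.ofReal k * μ C := by rw [hbad, add_zero]; exact hgood

end

open scoped Pointwise

section

variable {E : Type*} [NormedAddCommGroup E] [InnerProductSpace ℝ E] [FiniteDimensional ℝ E]

/-! ### Contact sets shrinking to the coincidence set -/

/-- The points of `B` at which `u - (1 - a) v - a ⟪p, ·⟫` attains its minimum over `B`, for some
slope `p ∈ W`. -/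
def contactSet (B W : Set E) (u v : E → ℝ) (a : ℝ) : Set E :=
  {x ∈ B | ∃ p ∈ W, ∀ y ∈ B,
    u x - (1 - a) * v x - a * inner ℝ p x ≤ u y - (1 - a) * v y - a * inner ℝ p y}

omit [FiniteDimensional ℝ E] in
lemma isCompact_contactSet {B W : Set E} {u v : E → ℝ} {a : ℝ} (hB : IsCompact B)
    (hW : IsCompact W) (hu : ContinuousOn u B) (hv : ContinuousOn v B) :
    IsCompact (contactSet B W u v a) := by
  have hprod := hB.prod hW
  have hfst : MapsTo (Prod.fst : E × E → E) (B ×ˢ W) B := fun z hz => hz.1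
  have hu' : ContinuousOn (fun z : E × E => u z.1) (B ×ˢ W) := hu.comp continuousOn_fst hfst
  have hv' : ContinuousOn (fun z : E × E => v z.1) (B ×ˢ W) := hv.comp continuousOn_fst hfst
  set D : Set (E × E) := (B ×ˢ W) ∩ ⋂ y ∈ B, {z ∈ B ×ˢ W |
    u z.1 - (1 - a) * v z.1 - a * inner ℝ z.2 z.1 ≤ u y - (1 - a) * v y - a * inner ℝ z.2 y}
  have hD : IsCompact D := by
    refine hprod.inter_right (isClosed_biInter fun y _ => ?_)
    refine hprod.isClosed.isClosed_le ?_ (Continuous.continuousOn (by fun_prop))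
    exact (hu'.sub (hv'.const_mul _)).sub (Continuous.continuousOn (by fun_prop))
  convert hD.image continuous_fst using 1
  ext x
  constructor
  · rintro ⟨hx, p, hp, h⟩
    exact ⟨(x, p), ⟨⟨hx, hp⟩, mem_iInter₂.mpr fun y hy => ⟨⟨hx, hp⟩, h y hy⟩⟩, rfl⟩
  · rintro ⟨⟨x', p⟩, ⟨⟨hx, hp⟩, h⟩, rfl⟩
    exact ⟨hx, p, hp, fun y hy => (mem_iInter₂.mp h y hy).2⟩

variable [MeasurableSpace E] [BorelSpace E]

/-- The local strong maximum principle, in terms of densities `ρu`, `ρv` of the Monge-Ampère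
measures of `u` and `v` whose ratio is controlled by the distance of the 1-jets of `u` and `v`.
If the coincidence set is not a neighbourhood of `x₀`, a ball `W` of slopes near `∇v(x₀)` avoids
the slopes of `v` on the coincidence set. The contact sets with slopes in `W` have measure bounded
below uniformly in `a`, and as `a → 0` they accumulate at points of the coincidence set `Z` which
minimize `v - ⟪p, ·⟫` over `Z`, `p ∈ W`. These are not points of density of `Z`. -/
lemma eventually_eq_of_touching (μ : Measure E) [μ.IsAddHaarMeasure] {x₀ : E} {r : ℝ} (hr : 0 < r)
    {u v ρu ρv : E → ℝ} {X Y : E → E} {L Lam : ℝ}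
    (hu : ∀ x ∈ closedBall x₀ r, HasGradientAt u (X x) x)
    (hv : ∀ x ∈ closedBall x₀ r, HasGradientAt v (Y x) x)
    (hXc : ContinuousOn X (closedBall x₀ r)) (hYc : ContinuousOn Y (closedBall x₀ r))
    (husub : ∀ x ∈ closedBall x₀ r, ∀ y ∈ closedBall x₀ r, x ≠ y →
      u x + inner ℝ (X x) (y - x) < u y)
    (hvsub : ∀ x ∈ closedBall x₀ r, ∀ y ∈ closedBall x₀ r, x ≠ y →
      v x + inner ℝ (Y x) (y - x) < v y)
    (hvconv : ConvexOn ℝ (ball x₀ r) v)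
    (huv : ∀ x ∈ closedBall x₀ r, v x ≤ u x) (htouch : u x₀ = v x₀)
    (hρu : ∀ T ⊆ ball x₀ r, MeasurableSet T → μ (X '' T) ≤ ∫⁻ x in T, ENNReal.ofReal (ρu x) ∂μ)
    (hρv : ∀ T ⊆ ball x₀ r, MeasurableSet T → ∫⁻ x in T, ENNReal.ofReal (ρv x) ∂μ ≤ μ (Y '' T))
    (hρvm : AEMeasurable ρv (μ.restrict (ball x₀ r)))
    (hρv0 : ∀ᵐ x ∂μ, x ∈ ball x₀ r → 0 < ρv x) (hLam : ∀ᵐ x ∂μ, x ∈ ball x₀ r → ρu x ≤ Lam)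
    (hL : 0 ≤ L) (hρ : ∀ᵐ x ∂μ, x ∈ ball x₀ r →
      ρu x ≤ (1 + L * (|u x - v x| + ‖X x - Y x‖)) * ρv x) :
    ∀ᶠ x in 𝓝 x₀, u x = v x := by
  by_contra hnot
  set B := closedBall x₀ r
  have hBc : IsCompact B := isCompact_closedBall x₀ r
  have hSB : ball x₀ r ⊆ B := ball_subset_closedBall
  have hx₀S : x₀ ∈ ball x₀ r := mem_ball_self hr
  have hx₀B : x₀ ∈ B := hSB hx₀S
  have hucont : ContinuousOn u B := fun x hx => (hu x hx).continuousAt.continuousWithinAt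
  have hvcont : ContinuousOn v B := fun x hx => (hv x hx).continuousAt.continuousWithinAt
  have husub' : ∀ x ∈ B, ∀ y ∈ B, u x + inner ℝ (X x) (y - x) ≤ u y := fun x hx y hy => by
    rcases eq_or_ne x y with rfl | hne
    · simp
    · exact (husub x hx y hy hne).le
  have hvsub' : ∀ x ∈ B, ∀ y ∈ B, v x + inner ℝ (Y x) (y - x) ≤ v y := fun x hx y hy => by
    rcases eq_or_ne x y with rfl | hne
    · simp
    · exact (hvsub x hx y hy hne).le
  -- Equal gradients at two points contradict strict convexity.
  have hinj : ∀ (f : E → ℝ) (P : E → E), (∀ x ∈ B, ∀ y ∈ B, x ≠ y →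
      f x + inner ℝ (P x) (y - x) < f y) → InjOn P B := by
    intro f P hf x hx y hy hxy
    by_contra hne
    have h1 := hf x hx y hy hne
    have h2 := hf y hy x hx (Ne.symm hne)
    rw [← hxy, ← neg_sub y x, inner_neg_right] at h2
    linarith
  have hXinj := hinj u X husub
  have hYinj := hinj v Y hvsub
  set Z : Set E := {x ∈ B | u x = v x}
  have hZclosed : IsClosed Z := by
    have := (hBc.isClosed.isClosed_le hucont hvcont)
    convert this using 1
    ext x
    exact ⟨fun h => ⟨h.1, h.2.le⟩, fun h => ⟨h.1, le_antisymm h.2 (huv x h.1)⟩⟩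
  have hZB : Z ⊆ B := fun x hx => hx.1
  have hZc : IsCompact Z := hBc.of_isClosed_subset hZclosed hZB
  have hx₀Z : x₀ ∈ Z := ⟨hx₀B, htouch⟩
  obtain ⟨δ, hδ0, hδ⟩ : ∃ δ : ℝ, 0 < δ ∧
      ∀ x ∈ sphere x₀ r, δ ≤ v x - v x₀ - inner ℝ (Y x₀) (x - x₀) := by
    refine (isCompact_sphere x₀ r).exists_forall_le' ?_ fun x hx => ?_
    · have h1 := hvcont.mono sphere_subset_closedBall
      exact (h1.sub continuousOn_const).sub (Continuous.continuousOn (by fun_prop))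
    · have hne : x₀ ≠ x := fun h => by
        rw [← h, mem_sphere, dist_self] at hx
        exact hr.ne hx
      linarith [hvsub x₀ hx₀B x (sphere_subset_closedBall hx) hne]
  set η : ℝ := δ / (2 * r)
  have hη : 0 < η := by positivity
  obtain ⟨y₀, hy₀ne, hy₀B, hy₀Y⟩ : ∃ y₀, u y₀ ≠ v y₀ ∧ y₀ ∈ ball x₀ r ∧ Y y₀ ∈ ball (Y x₀) η := by
    have h1 : ∃ᶠ y in 𝓝 x₀, u y ≠ v y := not_eventually.mp hnot
    have h2 : ∀ᶠ y in 𝓝 x₀, y ∈ ball x₀ r := isOpen_ball.mem_nhds hx₀S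
    have h3 : ∀ᶠ y in 𝓝 x₀, Y y ∈ ball (Y x₀) η :=
      (hYc.continuousAt (closedBall_mem_nhds x₀ hr)).eventually (ball_mem_nhds _ hη)
    obtain ⟨y, h⟩ := (h1.and_eventually (h2.and h3)).exists
    exact ⟨y, h.1, h.2.1, h.2.2⟩
  have hYZ : IsClosed (Y '' Z) := (hZc.image_of_continuousOn (hYc.mono hZB)).isClosed
  have hy₀Z : Y y₀ ∉ Y '' Z := by
    rintro ⟨z, hz, hzy⟩
    have := hYinj (hZB hz) (hSB hy₀B) hzy
    exact hy₀ne (this ▸ hz.2)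
  obtain ⟨τ, hτ0, hτ⟩ := nhds_basis_closedBall.mem_iff.mp
    ((hYZ.isOpen_compl.inter isOpen_ball).mem_nhds ⟨hy₀Z, hy₀Y⟩)
  set W := closedBall (Y y₀) τ
  have hWc : IsCompact W := isCompact_closedBall _ _
  have hWη : ∀ p ∈ W, ‖p - Y x₀‖ < η := fun p hp => by
    rw [← dist_eq_norm]; exact mem_ball.mp (hτ hp).2
  -- Slopes in `W` are so close to `∇v(x₀)` that minima over the ball are interior.
  have hinterior : ∀ p ∈ W, ∀ x ∈ B, v x - inner ℝ p x ≤ v x₀ - inner ℝ p x₀ →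
      x ∈ ball x₀ r := by
    intro p hp x hx hle
    by_contra hxs
    have hxr : ‖x - x₀‖ = r := by
      rw [← dist_eq_norm]
      exact le_antisymm (mem_closedBall.mp hx) (not_lt.mp hxs)
    have h1 := hδ x (by rw [mem_sphere, dist_eq_norm]; exact hxr)
    have h2 : inner ℝ (p - Y x₀) (x - x₀) ≤ η * r := by
      refine (real_inner_le_norm _ _).trans ?_
      rw [hxr]
      exact mul_le_mul_of_nonneg_right (hWη p hp).le hr.le
    have h3 : η * r = δ / 2 := by simp only [η]; field_simp
    rw [inner_sub_left, inner_sub_right p] at h2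
    linarith
  obtain ⟨m, hm⟩ : ∃ m, ∀ x ∈ B, |v x| ≤ m := by
    obtain ⟨m, hm⟩ := (hBc.image_of_continuousOn hvcont).isBounded.exists_norm_le
    exact ⟨m, fun x hx => hm _ (mem_image_of_mem v hx)⟩
  obtain ⟨m₁, hm₁⟩ := (hBc.image_of_continuousOn hYc).isBounded.exists_norm_le
  obtain ⟨m₂, hm₂⟩ := hWc.isBounded.exists_norm_le
  have hm0 : 0 ≤ m := (abs_nonneg _).trans (hm x₀ hx₀B)
  have hm₁0 : 0 ≤ m₁ := (norm_nonneg _).trans (hm₁ _ (mem_image_of_mem Y hx₀B))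
  have hm₂0 : 0 ≤ m₂ := (norm_nonneg _).trans (hm₂ (Y y₀) (mem_closedBall_self hτ0.le))
  set C : ℝ → Set E := contactSet B W u v
  have hwle : ∀ a, 0 < a → ∀ x ∈ B, ∀ p ∈ W, (∀ y ∈ B,
      u x - (1 - a) * v x - a * inner ℝ p x ≤ u y - (1 - a) * v y - a * inner ℝ p y) →
      u x - v x + a * (v x - inner ℝ p x) ≤ a * (v x₀ - inner ℝ p x₀) := by
    intro a ha x hx p hp h
    have := h x₀ hx₀B
    rw [htouch] at this
    linarith
  have hCint : ∀ a, 0 < a → ∀ x ∈ B, ∀ p ∈ W, (∀ y ∈ B,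
      u x - (1 - a) * v x - a * inner ℝ p x ≤ u y - (1 - a) * v y - a * inner ℝ p y) →
      x ∈ ball x₀ r := by
    intro a ha x hx p hp h
    refine hinterior p hp x hx (le_of_mul_le_mul_left ?_ ha)
    linarith [hwle a ha x hx p hp h, huv x hx]
  have hCgrad : ∀ a, 0 < a → ∀ x ∈ B, ∀ p ∈ W, (∀ y ∈ B,
      u x - (1 - a) * v x - a * inner ℝ p x ≤ u y - (1 - a) * v y - a * inner ℝ p y) →
      X x - (1 - a) • Y x = a • p := by
    intro a ha x hx p hp h
    have hxS := hCint a ha x hx p hp h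
    refine HasGradientAt.eq_of_isLocalMin
      (HasGradientAt.sub (hu x hx) (HasGradientAt.const_mul (1 - a) (hv x hx))) ?_
    filter_upwards [isOpen_ball.mem_nhds hxS] with y hy
    rw [real_inner_smul_left, real_inner_smul_left]
    exact h y (hSB hy)
  set M₁ : ℝ := 2 * m + m₂ * r
  have hwbound : ∀ a, 0 < a → ∀ x ∈ B, ∀ p ∈ W, (∀ y ∈ B,
      u x - (1 - a) * v x - a * inner ℝ p x ≤ u y - (1 - a) * v y - a * inner ℝ p y) →
      u x - v x ≤ a * M₁ := by
    intro a ha x hx p hp h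
    have h1 := hwle a ha x hx p hp h
    have h2 : inner ℝ p (x - x₀) ≤ m₂ * r := by
      refine (real_inner_le_norm _ _).trans ?_
      gcongr
      · exact hm₂ p hp
      · rw [← dist_eq_norm]; exact mem_closedBall.mp hx
    rw [inner_sub_right] at h2
    have h3 := abs_le.mp (hm x hx)
    have h4 := abs_le.mp (hm x₀ hx₀B)
    have h5 : a * (v x₀ - inner ℝ p x₀ - (v x - inner ℝ p x)) ≤ a * M₁ := by
      gcongr
      simp only [M₁]
      linarith [h3.1, h4.2]
    linarith
  set M : ℝ := L * (M₁ + (m₂ + m₁))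
  have hM : 0 ≤ M := by positivity
  set N := Module.finrank ℝ E
  set κ : ℝ := 2 ^ N * Lam * (2 ^ N * (M + N)) ^ N
  have hestimate : ∀ a, 0 < a → a ≤ 1 / 2 → μ W ≤ ENNReal.ofReal κ * μ (C a) := by
    intro a ha ha'
    have hCS : C a ⊆ ball x₀ r := fun x hx => by
      obtain ⟨hxB, p, hp, h⟩ := hx
      exact hCint a ha x hxB p hp h
    have hcontact := measure_contact_slopes_le μ (C := C a) isOpen_ball
      (fun x hx => hu x (hSB hx))
      (fun x hx => hv x (hSB hx)) (hXc.mono hSB) (hYc.mono hSB)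
      (fun x hx y hy => husub' x (hSB hx) y (hSB hy))
      (fun x hx y hy => hvsub' x (hSB hx) y (hSB hy)) (hXinj.mono hSB) hρu hρv hρvm hρv0 hLam
      (isCompact_contactSet hBc hWc hucont hvcont) hCS ha ha' hM ?_ ?_
    rotate_left
    · filter_upwards [hρ, hρv0] with x h1 h2 hx
      obtain ⟨hxB, p, hp, h⟩ := hx
      have hxS := hCint a ha x hxB p hp h
      have h3 : |u x - v x| ≤ a * M₁ := by
        rw [abs_of_nonneg (sub_nonneg.mpr (huv x hxB))]
        exact hwbound a ha x hxB p hp h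
      have h4 : ‖X x - Y x‖ ≤ a * (m₂ + m₁) := by
        have h5 : X x - Y x = a • (p - Y x) := by
          rw [smul_sub, ← hCgrad a ha x hxB p hp h, sub_smul, one_smul]; abel
        rw [h5, norm_smul, Real.norm_of_nonneg ha.le]
        gcongr
        exact (norm_sub_le _ _).trans
          (add_le_add (hm₂ p hp) (hm₁ _ (mem_image_of_mem Y hxB)))
      refine (h1 hxS).trans ?_
      have h6 := h2 hxS
      gcongr ?_ * ρv x
      calc 1 + L * (|u x - v x| + ‖X x - Y x‖) ≤ 1 + L * (a * M₁ + a * (m₂ + m₁)) := by gcongr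
        _ = 1 + M * a := by simp only [M]; ring
    · intro x hx y hy
      obtain ⟨hxB, p, hp, h⟩ := hx
      rw [hCgrad a ha x hxB p hp h, real_inner_smul_left, inner_sub_right]
      linarith [h y (hSB hy)]
    have hWsub : a • W ⊆ (fun x => X x - (1 - a) • Y x) '' C a := by
      rintro _ ⟨p, hp, rfl⟩
      have hc : ContinuousOn (fun x => u x - (1 - a) * v x - a * inner ℝ p x) B :=
        (hucont.sub (hvcont.const_mul _)).sub (Continuous.continuousOn (by fun_prop))
      obtain ⟨x, hx, hmin⟩ := hBc.exists_isMinOn ⟨x₀, hx₀B⟩ hc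
      exact ⟨x, ⟨hx, p, hp, fun y hy => hmin hy⟩, hCgrad a ha x hx p hp fun y hy => hmin hy⟩
    have h1 := (measure_mono hWsub).trans hcontact
    rw [Measure.addHaar_smul, abs_of_pos (pow_pos ha _)] at h1
    have h2 : 2 ^ N * Lam * (2 ^ N * (M + N) * a) ^ N = a ^ N * κ := by
      simp only [κ]; rw [mul_pow _ a]; ring
    rw [h2, ENNReal.ofReal_mul (by positivity), mul_assoc] at h1
    exact (ENNReal.mul_le_mul_iff_right (by simpa using pow_pos ha N) ENNReal.ofReal_ne_top).mp h1
  set a : ℕ → ℝ := fun k => 1 / ((k : ℝ) + 1 + 1)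
  have ha0 : ∀ k, 0 < a k := fun k => by positivity
  have ha1 : ∀ k, a k ≤ 1 / 2 := fun k => by
    simp only [a]
    gcongr
    linarith [Nat.cast_nonneg (α := ℝ) k]
  have halim : Tendsto a atTop (𝓝 0) := by
    have := (tendsto_one_div_add_atTop_nhds_zero_nat (𝕜 := ℝ)).comp (tendsto_add_atTop_nat 1)
    refine this.congr fun k => ?_
    simp [a]
  have hlim := le_measure_limitPoints μ (T := fun k => C (a k)) (R := B) isBounded_closedBall
    (fun k x hx => hx.1) (m := μ W / ENNReal.ofReal κ)
    fun k => ENNReal.div_le_of_le_mul' (hestimate (a k) (ha0 k) (ha1 k))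
  have hpoint : ∀ x, (∃ (k : ℕ → ℕ) (y : ℕ → E), Tendsto k atTop atTop ∧
      (∀ j, y j ∈ C (a (k j))) ∧ Tendsto y atTop (𝓝 x)) →
      x ∈ Z ∧ ∃ p ∈ W, ∀ z ∈ Z, v x - inner ℝ p x ≤ v z - inner ℝ p z := by
    rintro x ⟨k, y, hk, hy, hyx⟩
    choose hyB p hp hmin using hy
    obtain ⟨p₀, hp₀, φ, hφ, hpφ⟩ := hWc.tendsto_subseq hp
    have hxB : x ∈ B := hBc.isClosed.mem_of_tendsto hyx (Eventually.of_forall hyB)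
    have hyφ : Tendsto (fun j => y (φ j)) atTop (𝓝[B] x) :=
      tendsto_nhdsWithin_iff.mpr ⟨hyx.comp hφ.tendsto_atTop,
        Eventually.of_forall fun j => hyB _⟩
    have hyφ' := tendsto_nhds_of_tendsto_nhdsWithin hyφ
    have haφ : Tendsto (fun j => a (k (φ j))) atTop (𝓝 0) :=
      halim.comp (hk.comp hφ.tendsto_atTop)
    have hul : Tendsto (fun j => u (y (φ j))) atTop (𝓝 (u x)) := (hucont x hxB).tendsto.comp hyφ
    have hvl : Tendsto (fun j => v (y (φ j))) atTop (𝓝 (v x)) := (hvcont x hxB).tendsto.comp hyφ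
    have hpφ' : Tendsto (fun j => p (φ j)) atTop (𝓝 p₀) := hpφ
    have hxZ : x ∈ Z := by
      have h1 : u x - v x ≤ 0 * M₁ :=
        le_of_tendsto_of_tendsto' (hul.sub hvl) (haφ.mul_const M₁) fun j =>
          hwbound _ (ha0 _) _ (hyB _) _ (hp _) (hmin _)
      exact ⟨hxB, le_antisymm (by linarith) (huv x hxB)⟩
    refine ⟨hxZ, p₀, hp₀, fun z hz => ?_⟩
    refine le_of_tendsto_of_tendsto' (hvl.sub (hpφ'.inner hyφ'))
      (tendsto_const_nhds.sub (hpφ'.inner tendsto_const_nhds)) fun j => ?_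
    have h1 := hmin (φ j) z (hZB hz)
    have h2 := huv _ (hyB (φ j))
    rw [hz.2] at h1
    refine le_of_mul_le_mul_left ?_ (ha0 (k (φ j)))
    linarith
  have hzero : μ {x | ∃ (k : ℕ → ℕ) (y : ℕ → E), Tendsto k atTop atTop ∧
      (∀ j, y j ∈ C (a (k j))) ∧ Tendsto y atTop (𝓝 x)} = 0 := by
    refine measure_eq_zero_of_touching_convex μ hZclosed.measurableSet
      (fun x hx => (hpoint x hx).1) fun x hx => ?_
    obtain ⟨hxZ, p, hp, hmin⟩ := hpoint x hx
    have hxS := hinterior p hp x (hZB hxZ) (hmin x₀ hx₀Z)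
    have hcl : x ∈ closure {z ∈ ball x₀ r | v z - inner ℝ p z < v x - inner ℝ p x} := by
      rw [mem_closure_iff_frequently]
      intro hcon
      have hYp : Y x = p := by
        refine HasGradientAt.eq_of_isLocalMin (hv x (hZB hxZ)) ?_
        filter_upwards [hcon, isOpen_ball.mem_nhds hxS] with z h1 h2
        by_contra h3
        exact h1 ⟨h2, not_le.mp h3⟩
      exact (hτ hp).1 ⟨x, hxZ, hYp⟩
    refine ⟨_, ?_, ?_, closure_nonempty_iff.mp ⟨x, hcl⟩, hcl, ?_⟩
    · exact ((hvcont.mono hSB).sub (Continuous.continuousOn (by fun_prop))).isOpen_inter_preimage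
        isOpen_ball isOpen_Iio
    · have : ConvexOn ℝ (ball x₀ r) fun z => v z - inner ℝ p z :=
        hvconv.sub ((innerₛₗ ℝ p).concaveOn (convex_ball x₀ r))
      exact this.convex_lt _
    · rw [disjoint_left]
      intro z hz hzZ
      exact (hmin z hzZ).not_gt hz.2
  rw [hzero, nonpos_iff_eq_zero, ENNReal.div_eq_zero_iff] at hlim
  exact hlim.elim (measure_closedBall_pos μ _ hτ0).ne' ENNReal.ofReal_ne_top

end

/-! ### Subgradients and Aleksandrov inequalities on a domain -/

lemma lt_of_strictConvexOn {E : Type*} [NormedAddCommGroup E] [InnerProductSpace ℝ E]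
    [FiniteDimensional ℝ E] {f : E → ℝ} {S : Set E} {p x y : E} (hf : StrictConvexOn ℝ S f)
    (hx : x ∈ S) (hy : y ∈ S) (hxy : x ≠ y) (h : HasGradientAt f p x) :
    f x + inner ℝ p (y - x) < f y := by
  have h1 := hf.2 hx hy hxy (show (0 : ℝ) < 1 / 2 by norm_num) (show (0 : ℝ) < 1 / 2 by norm_num)
    (by norm_num)
  have hz : (1 / 2 : ℝ) • x + (1 / 2 : ℝ) • y ∈ S :=
    hf.1 hx hy (by norm_num) (by norm_num) (by norm_num)
  have h2 := add_inner_le_of_convexOn hf.convexOn hx hz h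
  have h3 : (1 / 2 : ℝ) • x + (1 / 2 : ℝ) • y - x = (1 / 2 : ℝ) • (y - x) := by module
  rw [h3, real_inner_smul_right] at h2
  rw [smul_eq_mul, smul_eq_mul] at h1
  linarith

section

variable {n : ℕ} {Ω : Set (EuclideanSpace ℝ (Fin n))}

lemma StrictlyConvex.strictConvexOn {u : EuclideanSpace ℝ (Fin n) → ℝ} (hu : StrictlyConvex Ω u)
    {S : Set (EuclideanSpace ℝ (Fin n))} (hS : Convex ℝ S) (hSΩ : S ⊆ Ω) :
    StrictConvexOn ℝ S u := by
  refine ⟨hS, fun x hx y hy hxy a b ha hb hab => ?_⟩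
  exact hu x y ((hS.segment_subset hx hy).trans hSΩ) hxy a b ha hb hab

lemma hasGradientAt_of_contDiffOn (hΩo : IsOpen Ω) {u : EuclideanSpace ℝ (Fin n) → ℝ}
    (hu : ContDiffOn ℝ 1 u Ω) {x : EuclideanSpace ℝ (Fin n)} (hx : x ∈ Ω) :
    HasGradientAt u (gradient u x) x :=
  ((hu.differentiableOn (by norm_num)).differentiableAt (hΩo.mem_nhds hx)).hasGradientAt

lemma continuousOn_gradient (hΩo : IsOpen Ω) {u : EuclideanSpace ℝ (Fin n) → ℝ}
    (hu : ContDiffOn ℝ 1 u Ω) : ContinuousOn (gradient u) Ω :=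
  (InnerProductSpace.toDual ℝ _).symm.continuous.comp_continuousOn
    (hu.continuousOn_fderiv_of_isOpen hΩo le_rfl)

lemma subgradient_subset_singleton (hΩo : IsOpen Ω) {u : EuclideanSpace ℝ (Fin n) → ℝ}
    (hu : ContDiffOn ℝ 1 u Ω) {x : EuclideanSpace ℝ (Fin n)} (hx : x ∈ Ω) :
    subgradient Ω u x ⊆ {gradient u x} := by
  intro p hp
  refine (HasGradientAt.eq_of_eventually_le (hasGradientAt_of_contDiffOn hΩo hu hx) ?_).symm
  filter_upwards [hΩo.mem_nhds hx] with y hy using hp y hy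

/-- The supremum defining the Legendre transform at a subgradient is attained. -/
lemma legendre_eq_of_mem_subgradient {u : EuclideanSpace ℝ (Fin n) → ℝ}
    {x p : EuclideanSpace ℝ (Fin n)} (hx : x ∈ Ω) (hp : p ∈ subgradient Ω u x) :
    legendre Ω u p = inner ℝ x p - u x := by
  have h : IsGreatest (range fun y : Ω => inner ℝ (y : EuclideanSpace ℝ (Fin n)) p - u y)
      (inner ℝ x p - u x) := by
    refine ⟨⟨⟨x, hx⟩, rfl⟩, ?_⟩
    rintro _ ⟨⟨y, hy⟩, rfl⟩
    have := hp y hy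
    rw [inner_sub_right, real_inner_comm y p, real_inner_comm x p] at this
    change inner ℝ y p - u y ≤ _
    linarith
  exact h.csSup_eq

/-- A positive lower bound for the Monge-Ampère measure forces `∂v(x)` to be nonempty on a dense
set, hence `∇v(x) ∈ ∂v(x)` everywhere by continuity of `∇v`: the tangent planes of `v` lie below
`v` on all of `Ω`, even if `Ω` is not convex. -/
lemma gradient_mem_subgradient_of_detHessianGE (hΩo : IsOpen Ω)
    {v ρ : EuclideanSpace ℝ (Fin n) → ℝ} (hv : ContDiffOn ℝ 1 v Ω) {c : ℝ} (hc : 0 < c)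
    (hρ : ∀ᵐ x ∂(volume.restrict Ω), c ≤ ρ x) (hvρ : DetHessianGE Ω v ρ) :
    ∀ x ∈ Ω, gradient v x ∈ subgradient Ω v x := by
  have hdense : ∀ x ∈ Ω, ∃ᶠ y in 𝓝[Ω] x, (subgradient Ω v y).Nonempty := by
    intro x hx
    by_contra hcon
    rw [not_frequently, hΩo.nhdsWithin_eq hx] at hcon
    obtain ⟨O, hO, hOo, hxO⟩ := _root_.mem_nhds_iff.mp (inter_mem hcon (hΩo.mem_nhds hx))
    have hOΩ : O ⊆ Ω := fun y hy => (hO hy).2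
    have h1 := hvρ O hOΩ hOo.measurableSet
    have h2 : maMeasure Ω v O = 0 := by
      have : ⋃ y ∈ O, subgradient Ω v y = ∅ := by
        simp only [iUnion_eq_empty]
        exact fun y hy => not_nonempty_iff_eq_empty.mp (hO hy).1
      rw [maMeasure, this, measure_empty]
    have h3 : ENNReal.ofReal c * volume O ≤ ∫⁻ x in O, ENNReal.ofReal (ρ x) := by
      rw [← setLIntegral_const]
      refine lintegral_mono_ae ?_
      filter_upwards [ae_restrict_of_ae_restrict_of_subset hOΩ hρ] with y hy
      exact ENNReal.ofReal_le_ofReal hy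
    rw [h2, nonpos_iff_eq_zero] at h1
    rw [h1, nonpos_iff_eq_zero, mul_eq_zero] at h3
    rcases h3 with h3 | h3
    · exact hc.not_ge (ENNReal.ofReal_eq_zero.mp h3)
    · exact (hOo.measure_pos volume ⟨x, hxO⟩).ne' h3
  intro x hx y hy
  by_contra hlt
  rw [not_le] at hlt
  have hcont : ContinuousWithinAt (fun z => v z + inner ℝ (gradient v z) (y - z)) Ω x :=
    (hv.continuousOn x hx).add
      ((continuousOn_gradient hΩo hv x hx).inner (continuousWithinAt_const.sub continuousWithinAt_id))
  have hev := hcont.eventually (lt_mem_nhds hlt)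
  obtain ⟨z, ⟨p, hp⟩, hz, hzΩ⟩ :=
    ((hdense x hx).and_eventually (hev.and self_mem_nhdsWithin)).exists
  have hpz := subgradient_subset_singleton hΩo hv hzΩ hp
  rw [mem_singleton_iff] at hpz
  subst hpz
  exact (hp y hy).not_gt hz

/-- Near a contact point, the gradients of `u` are subgradients over all of `Ω`: outside a small
ball `u ≥ v`, and `v` exceeds its tangent plane at the contact point by an amount which grows
linearly. -/
lemma eventually_gradient_mem_subgradient (hΩo : IsOpen Ω)
    {u v : EuclideanSpace ℝ (Fin n) → ℝ} (hu : ContDiffOn ℝ 1 u Ω) (hv : ContDiffOn ℝ 1 v Ω)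
    (huc : StrictlyConvex Ω u) (hvc : StrictlyConvex Ω v) (huv : ∀ x ∈ Ω, v x ≤ u x)
    (hvsub : ∀ x ∈ Ω, gradient v x ∈ subgradient Ω v x) {x₀ : EuclideanSpace ℝ (Fin n)}
    (hx₀ : x₀ ∈ Ω) (htouch : u x₀ = v x₀) :
    ∀ᶠ x in 𝓝 x₀, gradient u x ∈ subgradient Ω u x := by
  obtain ⟨r, hr, hrΩ⟩ := nhds_basis_closedBall.mem_iff.mp (hΩo.mem_nhds hx₀)
  set p₀ := gradient v x₀ with hp₀
  have hup₀ : gradient u x₀ = p₀ := by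
    refine HasGradientAt.eq_of_eventually_le (hasGradientAt_of_contDiffOn hΩo hu hx₀) ?_
    filter_upwards [hΩo.mem_nhds hx₀] with y hy
    rw [htouch]
    exact (hvsub x₀ hx₀ y hy).trans (huv y hy)
  obtain ⟨δ, hδ0, hδ⟩ : ∃ δ : ℝ, 0 < δ ∧
      ∀ x ∈ sphere x₀ r, δ ≤ v x - v x₀ - inner ℝ p₀ (x - x₀) := by
    refine (isCompact_sphere x₀ r).exists_forall_le' ?_ fun x hx => ?_
    · have h1 := hv.continuousOn.mono (sphere_subset_closedBall.trans hrΩ)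
      exact (h1.sub continuousOn_const).sub (Continuous.continuousOn (by fun_prop))
    · have hne : x₀ ≠ x := fun h => by
        rw [← h, mem_sphere, dist_self] at hx
        exact hr.ne hx
      linarith [lt_of_strictConvexOn (hvc.strictConvexOn (convex_closedBall x₀ r) hrΩ)
        (mem_closedBall_self hr.le) (sphere_subset_closedBall hx) hne
        (hasGradientAt_of_contDiffOn hΩo hv hx₀)]
  have hgrow : ∀ y ∈ Ω, r ≤ ‖y - x₀‖ →
      v x₀ + inner ℝ p₀ (y - x₀) + δ / r * ‖y - x₀‖ ≤ v y := by
    intro y hy hyr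
    set s := ‖y - x₀‖ / r with hs
    have hs1 : 1 ≤ s := (one_le_div hr).mpr hyr
    have hs0 : 0 < s := by linarith
    -- `x₁` is the radial projection of `y` to the sphere.
    set x₁ := x₀ + s⁻¹ • (y - x₀)
    have hyx₀ : 0 < ‖y - x₀‖ := hr.trans_le hyr
    have hx₁ : x₁ ∈ sphere x₀ r := by
      rw [mem_sphere, dist_eq_norm, add_sub_cancel_left, norm_smul, norm_inv,
        Real.norm_of_nonneg hs0.le, hs]
      field_simp
    have hx₁Ω : x₁ ∈ Ω := hrΩ (sphere_subset_closedBall hx₁)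
    have hd : y - x₀ = s • (x₁ - x₀) := by
      rw [add_sub_cancel_left, smul_smul, mul_inv_cancel₀ hs0.ne', one_smul]
    have h1 := hδ x₁ hx₁
    have h2 := hvsub x₁ hx₁Ω y hy
    have h3 := hvsub x₁ hx₁Ω x₀ hx₀
    have h4 : y - x₁ = (s - 1) • (x₁ - x₀) := by
      rw [sub_smul, ← hd, one_smul]; abel
    rw [h4, real_inner_smul_right] at h2
    rw [← neg_sub x₁ x₀, inner_neg_right] at h3
    have h5 : δ / r * ‖y - x₀‖ = s * δ := by rw [hs]; field_simp
    rw [h5, hd, real_inner_smul_right]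
    nlinarith [mul_le_mul_of_nonneg_left h3 (sub_nonneg.mpr hs1),
      mul_le_mul_of_nonneg_left h1 hs0.le]
  have hgc : ContinuousAt (gradient u) x₀ :=
    (continuousOn_gradient hΩo hu).continuousAt (hΩo.mem_nhds hx₀)
  have huc₀ : ContinuousAt u x₀ := hu.continuousOn.continuousAt (hΩo.mem_nhds hx₀)
  have hev1 : ∀ᶠ x in 𝓝 x₀, ‖gradient u x - p₀‖ < δ / (2 * r) := by
    have h : Tendsto (fun x => ‖gradient u x - p₀‖) (𝓝 x₀) (𝓝 0) := by
      have : ContinuousAt (fun x => ‖gradient u x - p₀‖) x₀ := (hgc.sub continuousAt_const).norm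
      simpa [hup₀] using this.tendsto
    exact h.eventually (gt_mem_nhds (by positivity))
  have hev2 : ∀ᶠ x in 𝓝 x₀, u x + inner ℝ (gradient u x) (x₀ - x) < u x₀ + δ / 2 := by
    have h : ContinuousAt (fun x => u x + inner ℝ (gradient u x) (x₀ - x)) x₀ :=
      huc₀.add (hgc.inner (continuousAt_const.sub continuousAt_id))
    exact h.eventually (gt_mem_nhds (by simp; positivity))
  filter_upwards [hev1, hev2, closedBall_mem_nhds x₀ hr] with x h1 h2 hxr y hy
  rcases le_total ‖y - x₀‖ r with hyr | hyr
  · exact add_inner_le_of_convexOn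
      (huc.strictConvexOn (convex_closedBall x₀ r) hrΩ).convexOn hxr
      (by rwa [mem_closedBall, dist_eq_norm]) (hasGradientAt_of_contDiffOn hΩo hu (hrΩ hxr))
  · have h3 := hgrow y hy hyr
    have h4 : inner ℝ (gradient u x) (y - x) = inner ℝ (gradient u x) (x₀ - x)
        + inner ℝ p₀ (y - x₀) + inner ℝ (gradient u x - p₀) (y - x₀) := by
      rw [inner_sub_left, ← sub_add_sub_cancel y x₀ x, inner_add_right]; ring
    have h5 : inner ℝ (gradient u x - p₀) (y - x₀) ≤ δ / (2 * r) * ‖y - x₀‖ :=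
      (real_inner_le_norm _ _).trans (by gcongr)
    have h6 : δ / r * ‖y - x₀‖ = 2 * (δ / (2 * r) * ‖y - x₀‖) := by field_simp
    have h7 : δ / 2 ≤ δ / (2 * r) * ‖y - x₀‖ := by
      calc δ / 2 = δ / (2 * r) * r := by field_simp
        _ ≤ δ / (2 * r) * ‖y - x₀‖ := by gcongr
    have h8 := huv y hy
    rw [h4]
    rw [htouch] at h2
    linarith

/-- The comparison of the right-hand sides for two 1-jets: their quotient differs from `1` by at
most a multiple of the distance of the jets. -/
lemma exists_rhs_le (hΩo : IsOpen Ω) {lam Lam : ℝ} (hlam : 0 < lam)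
    {f : EuclideanSpace ℝ (Fin n) → ℝ} {F G : EuclideanSpace ℝ (Fin n) × ℝ → ℝ}
    (hF : ∀ x ∈ Ω, ∀ r : ℝ, lam ≤ F (x, r) ∧ F (x, r) ≤ Lam)
    (hFL : LocallyLipschitzOn (Ω ×ˢ (univ : Set ℝ)) F)
    (hG : ∀ (p : EuclideanSpace ℝ (Fin n)) (r : ℝ), lam ≤ G (p, r) ∧ G (p, r) ≤ Lam)
    (hGL : LocallyLipschitz G) {u v : EuclideanSpace ℝ (Fin n) → ℝ}
    (hu : ContDiffOn ℝ 1 u Ω) (hv : ContDiffOn ℝ 1 v Ω)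
    {K : Set (EuclideanSpace ℝ (Fin n))} (hK : IsCompact K) (hKΩ : K ⊆ Ω)
    (husub : ∀ x ∈ K, gradient u x ∈ subgradient Ω u x)
    (hvsub : ∀ x ∈ K, gradient v x ∈ subgradient Ω v x) :
    ∃ L, 0 ≤ L ∧ ∀ x ∈ K, 0 ≤ f x → rhs Ω f F G u x
      ≤ (1 + L * (|u x - v x| + ‖gradient u x - gradient v x‖)) * rhs Ω f F G v x := by
  have huc := hu.continuousOn.mono hKΩ
  have hvc := hv.continuousOn.mono hKΩ
  have hXc := (continuousOn_gradient hΩo hu).mono hKΩ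
  have hYc := (continuousOn_gradient hΩo hv).mono hKΩ
  have hpair : ∀ w : EuclideanSpace ℝ (Fin n) → ℝ, ContinuousOn w K →
      ContinuousOn (gradient w) K →
      IsCompact ((fun x => (gradient w x, inner ℝ x (gradient w x) - w x)) '' K) := fun w hw hgw =>
    hK.image_of_continuousOn (hgw.prodMk ((continuousOn_id.inner hgw).sub hw))
  obtain ⟨LF, hLF⟩ := LocallyLipschitzOn.exists_lipschitzOnWith_of_compact
    ((hK.image_of_continuousOn (continuousOn_id.prodMk huc)).union
      (hK.image_of_continuousOn (continuousOn_id.prodMk hvc))) (hFL.mono (by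
        rintro _ (⟨x, hx, rfl⟩ | ⟨x, hx, rfl⟩) <;> exact ⟨hKΩ hx, mem_univ _⟩))
  obtain ⟨LG, hLG⟩ := LocallyLipschitzOn.exists_lipschitzOnWith_of_compact
    ((hpair u huc hXc).union (hpair v hvc hYc)) hGL.locallyLipschitzOn
  obtain ⟨R, hR⟩ := hK.isBounded.exists_norm_le
  obtain ⟨s₀, hs₀⟩ := (hK.image_of_continuousOn
    ((huc.sub hvc).abs.add (hXc.sub hYc).norm)).isBounded.exists_norm_le
  set R' := max R 0
  set α : ℝ := LF / lam
  set β : ℝ := LG * (1 + R') / lam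
  have hα : 0 ≤ α := by positivity
  have hβ : 0 ≤ β := by positivity
  refine ⟨α + β + α * β * max s₀ 0, by positivity, fun x hx hfx => ?_⟩
  set s := |u x - v x| + ‖gradient u x - gradient v x‖ with hs
  have hs0 : 0 ≤ s := by positivity
  have hss₀ : s ≤ max s₀ 0 := by
    refine le_trans ?_ (le_max_left _ _)
    exact (le_abs_self s).trans (hs₀ _ (mem_image_of_mem _ hx))
  have hxΩ := hKΩ hx
  simp only [rhs]
  rw [legendre_eq_of_mem_subgradient hxΩ (husub x hx),
    legendre_eq_of_mem_subgradient hxΩ (hvsub x hx)]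
  set Fu := F (x, u x)
  set Fv := F (x, v x)
  set Gu := G (gradient u x, inner ℝ x (gradient u x) - u x)
  set Gv := G (gradient v x, inner ℝ x (gradient v x) - v x)
  have hFu : lam ≤ Fu := (hF x hxΩ _).1
  have hFv : lam ≤ Fv := (hF x hxΩ _).1
  have hGu : lam ≤ Gu := (hG _ _).1
  have hGv : lam ≤ Gv := (hG _ _).1
  have h1 : Fu ≤ (1 + α * s) * Fv := by
    have h2 := hLF.dist_le_mul (x, u x) (Or.inl ⟨x, hx, rfl⟩) (x, v x) (Or.inr ⟨x, hx, rfl⟩)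
    rw [Prod.dist_eq, dist_self, Real.dist_eq, Real.dist_eq,
      max_eq_right (abs_nonneg _)] at h2
    have h3 : Fu - Fv ≤ LF * s := by
      refine (le_abs_self _).trans (h2.trans ?_)
      gcongr
      simp only [hs]
      linarith [norm_nonneg (gradient u x - gradient v x)]
    have h4 : LF * s ≤ α * s * Fv := by
      calc LF * s = α * s * lam := by simp only [α]; field_simp
        _ ≤ α * s * Fv := by gcongr
    linarith
  have h5 : Gv ≤ (1 + β * s) * Gu := by
    have h2 := hLG.dist_le_mul _ (Or.inr ⟨x, hx, rfl⟩) _ (Or.inl ⟨x, hx, rfl⟩)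
    have h3 : Gv - Gu ≤ LG * ((1 + R') * s) := by
      refine (le_abs_self _).trans (h2.trans ?_)
      gcongr
      rw [Prod.dist_eq]
      refine max_le ?_ ?_
      · rw [dist_comm, dist_eq_norm]
        calc ‖gradient u x - gradient v x‖ ≤ s := by
              simp only [hs]; linarith [abs_nonneg (u x - v x)]
          _ ≤ (1 + R') * s := le_mul_of_one_le_left hs0 (by simp [R'])
      · rw [dist_comm, Real.dist_eq]
        have h6 : inner ℝ x (gradient u x) - u x - (inner ℝ x (gradient v x) - v x)
            = inner ℝ x (gradient u x - gradient v x) - (u x - v x) := by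
          rw [inner_sub_right]; ring
        simp only [h6]
        have h7 : |inner ℝ x (gradient u x - gradient v x)|
            ≤ R' * ‖gradient u x - gradient v x‖ := by
          refine (abs_real_inner_le_norm _ _).trans ?_
          gcongr
          exact (hR x hx).trans (le_max_left _ _)
        have h8 : 0 ≤ R' * |u x - v x| := by positivity
        have h9 := norm_nonneg (gradient u x - gradient v x)
        refine (abs_sub _ _).trans ?_
        simp only [hs]
        linarith
    have h4 : LG * ((1 + R') * s) ≤ β * s * Gu := by
      calc LG * ((1 + R') * s) = β * s * lam := by simp only [β]; field_simp
        _ ≤ β * s * Gu := by gcongr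
    linarith
  have hFv0 : 0 < Fv := hlam.trans_le hFv
  have hGv0 : 0 < Gv := hlam.trans_le hGv
  have hGu0 : 0 < Gu := hlam.trans_le hGu
  have h6 : Fu / Gu ≤ (1 + α * s) * (1 + β * s) * (Fv / Gv) := by
    rw [← mul_div_assoc, div_le_div_iff₀ hGu0 hGv0]
    calc Fu * Gv ≤ ((1 + α * s) * Fv) * ((1 + β * s) * Gu) := by gcongr
      _ = _ := by ring
  have h7 : (1 + α * s) * (1 + β * s) ≤ 1 + (α + β + α * β * max s₀ 0) * s := by
    have : α * β * s * s ≤ α * β * max s₀ 0 * s := by gcongr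
    linarith
  calc f x * (Fu / Gu) ≤ f x * ((1 + (α + β + α * β * max s₀ 0) * s) * (Fv / Gv)) := by
        gcongr
        exact h6.trans (by gcongr)
    _ = _ := by ring

lemma le_rhs {lam Lam : ℝ} (hlam : 0 < lam) (hLam : lam ≤ Lam)
    {f : EuclideanSpace ℝ (Fin n) → ℝ} {F G : EuclideanSpace ℝ (Fin n) × ℝ → ℝ}
    {x : EuclideanSpace ℝ (Fin n)} (hf : lam ≤ f x ∧ f x ≤ Lam)
    (hF : ∀ r : ℝ, lam ≤ F (x, r) ∧ F (x, r) ≤ Lam)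
    (hG : ∀ (p : EuclideanSpace ℝ (Fin n)) (r : ℝ), lam ≤ G (p, r) ∧ G (p, r) ≤ Lam)
    (u : EuclideanSpace ℝ (Fin n) → ℝ) :
    lam * (lam / Lam) ≤ rhs Ω f F G u x ∧ rhs Ω f F G u x ≤ Lam * (Lam / lam) := by
  have h1 := hF (u x)
  have h2 := hG (gradient u x) (legendre Ω u (gradient u x))
  have h3 : 0 < Lam := hlam.trans_le hLam
  have h4 : 0 < G (gradient u x, legendre Ω u (gradient u x)) := hlam.trans_le h2.1
  have h5 : 0 < f x := hlam.trans_le hf.1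
  have h6 : 0 < F (x, u x) := hlam.trans_le h1.1
  simp only [rhs]
  constructor
  · gcongr
    exacts [hf.1, h1.1, h2.2]
  · gcongr
    exacts [hf.2, h1.2, h2.1]

lemma aemeasurable_rhs (hΩo : IsOpen Ω) {f : EuclideanSpace ℝ (Fin n) → ℝ}
    {F G : EuclideanSpace ℝ (Fin n) × ℝ → ℝ} (hfm : AEMeasurable f (volume.restrict Ω))
    (hFL : LocallyLipschitzOn (Ω ×ˢ (univ : Set ℝ)) F) (hGL : LocallyLipschitz G)
    (hG0 : ∀ z, G z ≠ 0) {v : EuclideanSpace ℝ (Fin n) → ℝ} (hv : ContDiffOn ℝ 1 v Ω)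
    (hvsub : ∀ x ∈ Ω, gradient v x ∈ subgradient Ω v x) :
    AEMeasurable (rhs Ω f F G v) (volume.restrict Ω) := by
  have hYc := continuousOn_gradient hΩo hv
  have h1 : ContinuousOn (fun x => F (x, v x) /
      G (gradient v x, inner ℝ x (gradient v x) - v x)) Ω := by
    refine ContinuousOn.div ?_ ?_ fun x _ => hG0 _
    · exact hFL.continuousOn.comp (continuousOn_id.prodMk hv.continuousOn)
        fun x hx => ⟨hx, mem_univ _⟩
    · exact hGL.continuous.comp_continuousOn
        (hYc.prodMk ((continuousOn_id.inner hYc).sub hv.continuousOn))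
  refine (hfm.mul (h1.aemeasurable hΩo.measurableSet)).congr ?_
  filter_upwards [ae_restrict_mem hΩo.measurableSet] with x hx
  simp only [rhs, Pi.mul_apply]
  rw [legendre_eq_of_mem_subgradient hx (hvsub x hx)]

end

end MongeAmpere

theorem theorem1p5 {n : ℕ} (Ω : Set (EuclideanSpace ℝ (Fin n)))
    (hΩo : IsOpen Ω) (hΩc : IsConnected Ω)
    (lam Lam : ℝ) (hlam : 0 < lam)
    (f : EuclideanSpace ℝ (Fin n) → ℝ) (F G : EuclideanSpace ℝ (Fin n) × ℝ → ℝ)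
    (hfm : AEMeasurable f (volume.restrict Ω))
    (hf : ∀ᵐ x ∂(volume.restrict Ω), lam ≤ f x ∧ f x ≤ Lam)
    (hF : ∀ x ∈ Ω, ∀ r : ℝ, lam ≤ F (x, r) ∧ F (x, r) ≤ Lam)
    (hFL : LocallyLipschitzOn (Ω ×ˢ (univ : Set ℝ)) F)
    (hG : ∀ (p : EuclideanSpace ℝ (Fin n)) (r : ℝ), lam ≤ G (p, r) ∧ G (p, r) ≤ Lam)
    (hGL : LocallyLipschitz G)
    (u v : EuclideanSpace ℝ (Fin n) → ℝ)
    (hu1 : ContDiffOn ℝ 1 u Ω) (hv1 : ContDiffOn ℝ 1 v Ω)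
    (huc : MongeAmpere.StrictlyConvex Ω u) (hvc : MongeAmpere.StrictlyConvex Ω v)
    (huv : ∀ x ∈ Ω, v x ≤ u x)
    (hu : MongeAmpere.DetHessianLE Ω u (MongeAmpere.rhs Ω f F G u))
    (hv : MongeAmpere.DetHessianGE Ω v (MongeAmpere.rhs Ω f F G v)) :
    (∀ x ∈ Ω, v x < u x) ∨ (∀ x ∈ Ω, u x = v x) := by
  open MongeAmpere Filter Topology Metric in
  have hLam : lam ≤ Lam := (hG 0 0).1.trans (hG 0 0).2
  have hLam0 : 0 < Lam := hlam.trans_le hLam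
  have hrhs : ∀ w : EuclideanSpace ℝ (Fin n) → ℝ, ∀ᵐ x ∂volume, x ∈ Ω →
      lam * (lam / Lam) ≤ rhs Ω f F G w x ∧ rhs Ω f F G w x ≤ Lam * (Lam / lam) := fun w => by
    filter_upwards [(ae_restrict_iff' hΩo.measurableSet).mp hf] with x hx hxΩ
    exact le_rhs hlam hLam (hx hxΩ) (hF x hxΩ) hG w
  have hc0 : 0 < lam * (lam / Lam) := by positivity
  have hvsub : ∀ x ∈ Ω, gradient v x ∈ subgradient Ω v x := by
    refine gradient_mem_subgradient_of_detHessianGE hΩo hv1 hc0 ?_ hv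
    rw [ae_restrict_iff' hΩo.measurableSet]
    filter_upwards [hrhs v] with x hx hxΩ using (hx hxΩ).1
  have hlocal : ∀ x₀ ∈ Ω, u x₀ = v x₀ → ∀ᶠ x in 𝓝 x₀, u x = v x := by
    intro x₀ hx₀ htouch
    have husub := eventually_gradient_mem_subgradient hΩo hu1 hv1 huc hvc huv hvsub hx₀ htouch
    obtain ⟨r, hr, hball⟩ := nhds_basis_closedBall.mem_iff.mp
      (inter_mem husub (hΩo.mem_nhds hx₀))
    have hBΩ : closedBall x₀ r ⊆ Ω := fun x hx => (hball hx).2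
    have hSΩ : ball x₀ r ⊆ Ω := ball_subset_closedBall.trans hBΩ
    have husub' : ∀ x ∈ closedBall x₀ r, gradient u x ∈ subgradient Ω u x :=
      fun x hx => (hball hx).1
    obtain ⟨L, hL0, hL⟩ := exists_rhs_le (f := f) hΩo hlam hF hFL hG hGL hu1 hv1
      (isCompact_closedBall x₀ r) hBΩ husub' fun x hx => hvsub x (hBΩ hx)
    have hconv := convex_closedBall x₀ r
    refine eventually_eq_of_touching volume hr (ρu := rhs Ω f F G u) (ρv := rhs Ω f F G v)
      (Lam := Lam * (Lam / lam))
      (fun x hx => hasGradientAt_of_contDiffOn hΩo hu1 (hBΩ hx))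
      (fun x hx => hasGradientAt_of_contDiffOn hΩo hv1 (hBΩ hx))
      ((continuousOn_gradient hΩo hu1).mono hBΩ) ((continuousOn_gradient hΩo hv1).mono hBΩ)
      (fun x hx y hy hxy => lt_of_strictConvexOn (huc.strictConvexOn hconv hBΩ) hx hy hxy
        (hasGradientAt_of_contDiffOn hΩo hu1 (hBΩ hx)))
      (fun x hx y hy hxy => lt_of_strictConvexOn (hvc.strictConvexOn hconv hBΩ) hx hy hxy
        (hasGradientAt_of_contDiffOn hΩo hv1 (hBΩ hx)))
      (hvc.strictConvexOn (convex_ball x₀ r) hSΩ).convexOn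
      (fun x hx => huv x (hBΩ hx)) htouch ?_ ?_
      ((aemeasurable_rhs hΩo hfm hFL hGL (fun z => (hlam.trans_le (hG z.1 z.2).1).ne') hv1
        hvsub).mono_measure (Measure.restrict_mono hSΩ le_rfl)) ?_ ?_ hL0 ?_
    · intro T hT hTm
      refine le_trans (measure_mono ?_) (hu T (hT.trans hSΩ) hTm)
      rintro _ ⟨x, hx, rfl⟩
      exact mem_biUnion hx (husub' x (ball_subset_closedBall (hT hx)))
    · intro T hT hTm
      refine (hv T (hT.trans hSΩ) hTm).trans (measure_mono ?_)
      refine iUnion₂_subset fun x hx p hp => ?_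
      exact ⟨x, hx, (subgradient_subset_singleton hΩo hv1 (hSΩ (hT hx)) hp).symm⟩
    · filter_upwards [hrhs v] with x hx hxS using hc0.trans_le (hx (hSΩ hxS)).1
    · filter_upwards [hrhs u] with x hx hxS using (hx (hSΩ hxS)).2
    · filter_upwards [(ae_restrict_iff' hΩo.measurableSet).mp hf] with x hx hxS
      exact hL x (ball_subset_closedBall hxS) (hlam.le.trans (hx (hSΩ hxS)).1)
  have hopen₁ : IsOpen {x ∈ Ω | v x < u x} := by
    have heq : {x ∈ Ω | v x < u x} = Ω ∩ (fun x => u x - v x) ⁻¹' Ioi 0 := by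
      ext x
      exact ⟨fun h => ⟨h.1, sub_pos.mpr h.2⟩, fun h => ⟨h.1, sub_pos.mp h.2⟩⟩
    rw [heq]
    exact (hu1.continuousOn.sub hv1.continuousOn).isOpen_inter_preimage hΩo isOpen_Ioi
  have hopen₂ : IsOpen {x | ∀ᶠ y in 𝓝 x, u y = v y} := isOpen_setOfPred_eventually_nhds
  have hcover : Ω ⊆ {x ∈ Ω | v x < u x} ∪ {x | ∀ᶠ y in 𝓝 x, u y = v y} := by
    intro x hx
    rcases (huv x hx).lt_or_eq with h | h
    · exact Or.inl ⟨hx, h⟩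
    · exact Or.inr (hlocal x hx h.symm)
  have hdisj : Ω ∩ ({x ∈ Ω | v x < u x} ∩ {x | ∀ᶠ y in 𝓝 x, u y = v y}) = ∅ := by
    refine eq_empty_of_forall_notMem ?_
    rintro x ⟨-, ⟨-, h1⟩, h2⟩
    exact h1.ne' h2.self_of_nhds
  rcases isPreconnected_iff_subset_of_disjoint.mp hΩc.isPreconnected _ _ hopen₁ hopen₂ hcover hdisj
    with h | h
  · exact Or.inl fun x hx => (h hx).2
  · exact Or.inr fun x hx => (h hx : ∀ᶠ y in 𝓝 x, u y = v y).self_of_nhds
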